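/- Let $\mathcal A=\{0,1,2,3\}$, let $\varphi$ be the morphism of $\mathcal A^*$ given by $\varphi(0)=0130$, $\varphi(1)=1021$, $\varphi(2)=102$, $\varphi(3)=013$, and let $\mathbf u$ be the infinite word of which all the words $\varphi^n(0)$, $n\ge 0$, are prefixes. Let $\theta_1,\theta_2$ be the antimorphisms of $\mathcal A^*$ (that is, $\theta_i(vw)=\theta_i(w)\theta_i(v)$) such that $\theta_1$ exchanges the letters $0,1$ and fixes $2,3$, and $\theta_2$ exchanges $2,3$ and fixes $0,1$, and let $G=\{\mathrm{Id},\theta_1,\theta_2,\theta_1\theta_2\}$. Let $\mathcal L(\mathbf u)$ be the set of factors of $\mathbf u$, $\mathcal L_n(\mathbf u)$ the set of factors of length $n$, $\mathcal C(n)=\#\mathcal L_n(\mathbf u)$ and $\Delta\mathcal C(n)=\mathcal C(n+1)-\mathcal C(n)$. A factor $w$ is bispecial if there are at least two letters $a$ with $aw\in\mathcal L(\mathbf u)$ and at least two letters $b$ with $wb\in\mathcal L(\mathbf u)$. The frequency of a factor $w$ is $$\rho(w)=\lim_{|v|\to\infty,\ v\in\mathcal L(\mathbf u)}\frac{\#\{\text{occurrences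 of } w \text{ in } v\}}{|v|}.$$ Then the following hold. 1. $\varphi$ is primitive, $\varphi(\mathbf u)=\mathbf u$, the word $\mathbf u$ is uniformly recurrent and not eventually periodic, and $\rho(w)$ exists for every $w\in\mathcal L(\mathbf u)$. 2. $G$ is a group (under composition) of order $4$ consisting of morphisms and antimorphisms, its antimorphisms are exactly $\theta_1$ and $\theta_2$, and $\mathcal L(\mathbf u)$ is invariant under every element of $G$. 3. For every $n\ge 1$, $$\#\{\rho(e)\mid e\in\mathcal L_{n+1}(\mathbf u)\}=\frac{1}{\#G}\bigl(4\Delta\mathcal C(n)+\#G-X-Y\bigr),$$ where $X$ is the number of bispecial factors of length $n$ and $Y$ is the number of bispecial factors $w$ of length $n$ with $\theta_1(w)=w$ or $\theta_2(w)=w$. 4. For every $n\ge 1$, $\#\{\rho(e)\mid e\in\mathcal L_{n+1}(\mathbf u)\}$ is $2$ if $\mathcal L_n(\mathbf u)$ contains a bispecial factor, and $3$ otherwise. -/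

import Mathlib

namespace SymWord

/-! Finite words over `A` are lists; right-sided infinite words are maps `ℕ → A`. -/

section General

variable {A : Type*}

/-- The factor of length `n` of the infinite word `u` that starts at index `k`. -/
def window (u : ℕ → A) (k n : ℕ) : List A :=
  (List.range n).map fun i => u (k + i)

/-- `w` is a prefix of the infinite word `u`. -/
def IsPrefixOf (w : List A) (u : ℕ → A) : Prop :=
  w = window u 0 w.length

/-- The set of all factors of `u` (the empty word included). -/
def language (u : ℕ → A) : Set (List A) :=
  {w | ∃ k, w = window u k w.length}

/-- The set of factors of length `n` of `u`. -/
def factors (u : ℕ → A) (n : ℕ) : Set (List A) :=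
  {w | w ∈ language u ∧ w.length = n}

/-- The factor complexity of `u`. -/
noncomputable def complexity (u : ℕ → A) (n : ℕ) : ℕ :=
  (factors u n).ncard

/-- The first difference of the factor complexity. -/
noncomputable def deltaC (u : ℕ → A) (n : ℕ) : ℤ :=
  (complexity u (n + 1) : ℤ) - complexity u n

/-- Right extensions of `w` in `u`. -/
def rext (u : ℕ → A) (w : List A) : Set A :=
  {a | w ++ [a] ∈ language u}

/-- Left extensions of `w` in `u`. -/
def lext (u : ℕ → A) (w : List A) : Set A :=
  {a | a :: w ∈ language u}

/-- `w` is a bispecial factor of `u`: a factor with at least two left extensions and at least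
two right extensions. -/
def IsBispecial (u : ℕ → A) (w : List A) : Prop :=
  w ∈ language u ∧ 2 ≤ (lext u w).ncard ∧ 2 ≤ (rext u w).ncard

/-- The set of bispecial factors of length `n` of `u`. -/
def bispecials (u : ℕ → A) (n : ℕ) : Set (List A) :=
  {w | IsBispecial u w ∧ w.length = n}

/-- The number of occurrences of `w` in the finite word `v`, that is, of indices `i` of letters
of `v` such that `w` is a prefix of the suffix of `v` starting at `i`. -/
noncomputable def occ (w v : List A) : ℕ :=
  {i : ℕ | i < v.length ∧ w <+: v.drop i}.ncard

/-- `r` is the frequency of `w` in `u`: the ratio `occ w v / |v|` tends to `r` as `|v|` tends to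
infinity, `v` running through all factors of `u`. -/
def HasFrequency (u : ℕ → A) (w : List A) (r : ℝ) : Prop :=
  Filter.Tendsto (fun v : List A => (occ w v : ℝ) / (v.length : ℝ))
    (Filter.comap List.length Filter.atTop ⊓ Filter.principal (language u)) (nhds r)

/-- The set `{ρ(e) | e a factor of length n}` of frequencies of factors of length `n`. -/
def frequencies (u : ℕ → A) (n : ℕ) : Set ℝ :=
  {r | ∃ e ∈ factors u n, HasFrequency u e r}

/-- Every factor of `u` occurs in `u` infinitely often and with bounded gaps. -/
def IsUniformlyRecurrent (u : ℕ → A) : Prop :=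
  ∀ w ∈ language u, ∃ R : ℕ, ∀ i, ∃ j, i ≤ j ∧ j ≤ i + R ∧ w = window u j w.length

/-- `u` is not eventually periodic. -/
def IsAperiodic (u : ℕ → A) : Prop :=
  ¬ ∃ p : ℕ, 0 < p ∧ ∃ N : ℕ, ∀ i, N ≤ i → u (i + p) = u i

/-- Morphisms of the free monoid of words. -/
def IsMorphism (f : List A → List A) : Prop :=
  ∀ v w, f (v ++ w) = f v ++ f w

/-- Antimorphisms of the free monoid of words. -/
def IsAntimorphism (f : List A → List A) : Prop :=
  ∀ v w, f (v ++ w) = f w ++ f v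

/-- The morphism with given images of letters. -/
def morph (f : A → List A) (w : List A) : List A :=
  w.flatMap f

/-- The morphism given by `f` is primitive: some power of its incidence matrix
`M i j = |f j|_i` has all entries positive. -/
def IsPrimitiveMorph [Fintype A] [DecidableEq A] (f : A → List A) : Prop :=
  ∃ k : ℕ, ∀ i j : A,
    0 < ((Matrix.of fun i j : A => (f j).count i : Matrix A A ℕ) ^ k) i j

/-- The antimorphism that acts on letters by the permutation `σ`. -/
def antimorph (σ : Equiv.Perm A) : Equiv.Perm (List A) where
  toFun w := (w.map σ).reverse
  invFun w := (w.map σ.symm).reverse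
  left_inv w := by simp [Function.comp_def]
  right_inv w := by simp [Function.comp_def]

theorem antimorph_mul (σ τ : Equiv.Perm A) (w : List A) :
    (antimorph σ * antimorph τ) w = w.map (σ * τ) := by
  simp [antimorph, Function.comp_def]

end General

/-- Images of letters under the morphism `0 → 0130, 1 → 1021, 2 → 102, 3 → 013`. -/
def phiLetter : Fin 4 → List (Fin 4) :=
  ![[0, 1, 3, 0], [1, 0, 2, 1], [1, 0, 2], [0, 1, 3]]

/-- The morphism `0 → 0130, 1 → 1021, 2 → 102, 3 → 013`. -/
def phi : List (Fin 4) → List (Fin 4) :=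
  morph phiLetter

/-- The fixed point of `phi` starting in `0`: its letter at index `i` is the letter at index `i`
of `phi^i(0)`, a word of length greater than `i`. -/
def fixedPt (i : ℕ) : Fin 4 :=
  (phi^[i] [0]).getD i 0

/-- The antimorphism exchanging `0` and `1` and fixing `2` and `3`. -/
def theta1 : Equiv.Perm (List (Fin 4)) :=
  antimorph (Equiv.swap 0 1)

/-- The antimorphism exchanging `2` and `3` and fixing `0` and `1`. -/
def theta2 : Equiv.Perm (List (Fin 4)) :=
  antimorph (Equiv.swap 2 3)

theorem theta1_sq : theta1 * theta1 = 1 := by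
  ext1 w; simp [theta1, antimorph_mul]

theorem theta2_sq : theta2 * theta2 = 1 := by
  ext1 w; simp [theta2, antimorph_mul]

theorem theta_comm : theta2 * theta1 = theta1 * theta2 := by
  ext1 w
  rw [theta1, theta2, antimorph_mul, antimorph_mul]
  congr 2
  decide

/-- The group `{Id, θ₁, θ₂, θ₁θ₂}`. -/
def symGroup : Subgroup (Equiv.Perm (List (Fin 4))) where
  carrier := {1, theta1, theta2, theta1 * theta2}
  one_mem' := by simp
  mul_mem' := by
    have h1 := theta1_sq
    have h2 := theta2_sq
    have h3 := theta_comm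
    have h4 : ∀ x, theta1 * (theta1 * x) = x := fun x => by rw [← mul_assoc, h1, one_mul]
    have h6 : ∀ x, theta2 * (theta1 * x) = theta1 * (theta2 * x) := fun x => by
      rw [← mul_assoc, h3, mul_assoc]
    rintro a b (rfl | rfl | rfl | rfl) (rfl | rfl | rfl | rfl) <;>
      simp [mul_assoc, h1, h2, h3, h4, h6]
  inv_mem' := by
    have i1 : theta1⁻¹ = theta1 := inv_eq_of_mul_eq_one_left theta1_sq
    have i2 : theta2⁻¹ = theta2 := inv_eq_of_mul_eq_one_left theta2_sq
    rintro a (rfl | rfl | rfl | rfl) <;> simp [i1, i2, theta_comm]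

theorem phi_iterate_prefix_succ (n : ℕ) : phi^[n] [0] <+: phi^[n + 1] [0] := by
  induction n with
  | zero => decide
  | succ n ih =>
    obtain ⟨t, ht⟩ := ih
    refine ⟨phi t, ?_⟩
    have h : phi (phi^[n] [0]) ++ phi t = phi (phi^[n + 1] [0]) := by
      rw [← ht]; simp [phi, morph]
    rw [Function.iterate_succ_apply' phi (n + 1), ← h, Function.iterate_succ_apply' phi n]

theorem phi_iterate_prefix {m n : ℕ} (h : m ≤ n) : phi^[m] [0] <+: phi^[n] [0] := by
  induction h with
  | refl => exact List.prefix_rfl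
  | step _ ih => exact ih.trans (phi_iterate_prefix_succ _)

theorem length_phi (w : List (Fin 4)) : 3 * w.length ≤ (phi w).length := by
  induction w with
  | nil => simp
  | cons a w ih =>
    have : phi (a :: w) = phiLetter a ++ phi w := by simp [phi, morph]
    have h3 : 3 ≤ (phiLetter a).length := by fin_cases a <;> decide
    rw [this, List.length_append, List.length_cons]
    omega

theorem lt_length_phi_iterate (n : ℕ) : n < (phi^[n] [0]).length := by
  induction n with
  | zero => simp
  | succ n ih =>
    have := length_phi (phi^[n] [0])
    rw [Function.iterate_succ_apply']
    omega

/-- Every `phi^n(0)` is a prefix of `fixedPt`. -/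
theorem isPrefixOf_fixedPt (n : ℕ) : IsPrefixOf (phi^[n] [0]) fixedPt := by
  have key : ∀ m k i : ℕ, m ≤ k → i < (phi^[m] [0]).length →
      (phi^[m] [0]).getD i 0 = (phi^[k] [0]).getD i 0 := by
    intro m k i hmk hi
    obtain ⟨t, ht⟩ := phi_iterate_prefix hmk
    rw [← ht, List.getD_append _ _ _ _ hi]
  unfold IsPrefixOf window
  refine List.ext_getElem (by simp) fun i h1 h2 => ?_
  rw [List.getElem_map, List.getElem_range, zero_add, ← List.getD_eq_getElem _ 0 h1]
  unfold fixedPt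
  rcases le_total n i with h | h
  · exact key n i i h h1
  · exact (key i n i h (lt_length_phi_iterate i)).symm

end SymWord

open SymWord

/-! Forget the difference between 0 and 1 and between 2 and 3 (`kind`). Every image `phiLetter a`
contains exactly one letter of {2,3}, always in third position, so the coded word is Sturmian: the
prefix of length m has ⌊(m+1)s⌋ letters 2, 3, where s = 2 - √3 solves s² = 4s - 1
(`prefix_discrepancy`). Hence it is balanced, and since s is irrational it is not eventually
periodic. Little is lost by coding: a letter has at most one neighbour of each kind on either side
(`Adj`), so a factor is determined by its coding and one adjacent letter, and the only remaining
freedom is the letter exchange `flip`, which is θ₁θ₂.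

Balance then shows that two right special factors of equal positive length agree up to `flip`
(`IsRightSpecial.eq_or_eq`). So there are exactly two of each length, exchanged by `flip`; the
antimorphism θ₁ gives the same for left special ones. This yields ΔC(n) = 2, and either no bispecial
factor of length n or exactly two, each fixed by θ₁ or θ₂ (`IsBispecial.palindrome`).

Frequencies exist by induction on length from the letters: extending a non-special factor does not
change its frequency, and at a bispecial factor one of the extensions is already known. Sliding a
window until its overlap with the next one is special, every frequency in length n+1 is x, y or x+y,
where x and y belong to the two extensions of a right special factor. The value x+y occurs exactly
when some special factor is not bispecial. Finally x, y, x+y are distinct, since otherwise all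
frequencies would be integer multiples of one number, contradicting the irrationality of s
(`freq_not_commensurable`). -/

namespace SymWord

/-! ### Factors as windows of an infinite word -/

section Windows

variable {A : Type*} (u : ℕ → A)

@[simp] theorem length_window (k n : ℕ) : (window u k n).length = n := by simp [window]

theorem window_add (k m n : ℕ) :
    window u k (m + n) = window u k m ++ window u (k + m) n := by
  simp [window, List.range_add, Function.comp_def, add_assoc]

theorem window_zero (k : ℕ) : window u k 0 = [] := rfl

theorem window_one (k : ℕ) : window u k 1 = [u k] := by simp [window]

theorem window_succ (k n : ℕ) : window u k (n + 1) = window u k n ++ [u (k + n)] := by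
  rw [window_add, window_one]

theorem window_succ' (k n : ℕ) : window u k (n + 1) = u k :: window u (k + 1) n := by
  rw [add_comm, window_add, window_one]; rfl

theorem window_mem_language (k n : ℕ) : window u k n ∈ language u := ⟨k, by simp⟩

variable {u}

theorem mem_language_iff {w : List A} : w ∈ language u ↔ ∃ k n, w = window u k n :=
  ⟨fun ⟨k, h⟩ => ⟨k, _, h⟩, by rintro ⟨k, n, rfl⟩; exact window_mem_language u k n⟩

theorem eq_window_of_append {v w : List A} {k n : ℕ} (h : v ++ w = window u k n) :
    v = window u k v.length ∧ w = window u (k + v.length) w.length := by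
  have hn : n = v.length + w.length := by simpa using (congrArg List.length h).symm
  rw [hn, window_add] at h
  exact List.append_inj h (by simp)

theorem mem_language_of_infix {v w : List A} (h : v <:+: w) (hw : w ∈ language u) :
    v ∈ language u := by
  obtain ⟨s, t, rfl⟩ := h
  obtain ⟨k, hk⟩ := hw
  have h1 := (eq_window_of_append hk).1
  exact ⟨_, (eq_window_of_append h1).2⟩

theorem rext_nonempty {w : List A} (hw : w ∈ language u) : (rext u w).Nonempty := by
  obtain ⟨k, hk⟩ := hw
  refine ⟨u (k + w.length), k, ?_⟩
  rw [List.length_append, List.length_singleton, window_succ, ← hk]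

end Windows

/-! ### The fixed point equation and desubstitution -/

theorem phi_append (v w : List (Fin 4)) : phi (v ++ w) = phi v ++ phi w := by simp [phi, morph]

theorem phi_cons (a : Fin 4) (w : List (Fin 4)) : phi (a :: w) = phiLetter a ++ phi w := by
  simp [phi, morph]

theorem phi_nil : phi [] = [] := rfl

theorem phi_singleton (a : Fin 4) : phi [a] = phiLetter a := by simp [phi, morph]

theorem length_phi_le (w : List (Fin 4)) : (phi w).length ≤ 4 * w.length := by
  induction w with
  | nil => simp [phi_nil]
  | cons a w ih =>
    have h4 : (phiLetter a).length ≤ 4 := by fin_cases a <;> decide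
    rw [phi_cons, List.length_append, List.length_cons]
    omega

theorem phi_iterate_mem_language (n : ℕ) : phi^[n] [0] ∈ language fixedPt :=
  ⟨0, isPrefixOf_fixedPt n⟩

theorem window_prefix_iterate {m n : ℕ} (h : m ≤ n) :
    window fixedPt 0 m <+: phi^[n] [0] := by
  have hp := isPrefixOf_fixedPt n
  rw [IsPrefixOf] at hp
  have hl := lt_length_phi_iterate n
  obtain ⟨d, hd⟩ := Nat.exists_eq_add_of_le (h.trans hl.le)
  rw [hd, window_add] at hp
  exact ⟨_, hp.symm⟩

/-- This is the invariance of the infinite word under `phi`, expressed on prefixes. -/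
theorem phi_window_isPrefixOf (n : ℕ) : IsPrefixOf (phi (window fixedPt 0 n)) fixedPt := by
  obtain ⟨t, ht⟩ := window_prefix_iterate (le_refl n)
  have hp := isPrefixOf_fixedPt (n + 1)
  rw [Function.iterate_succ_apply', ← ht, phi_append] at hp
  exact (eq_window_of_append hp).1

/-- The length of the image under `phi` of the prefix of length `m` of `fixedPt`. -/
def phiPos (m : ℕ) : ℕ := (phi (window fixedPt 0 m)).length

theorem phiPos_zero : phiPos 0 = 0 := rfl

theorem phiPos_add (m n : ℕ) :
    phiPos (m + n) = phiPos m + (phi (window fixedPt m n)).length := by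
  simp [phiPos, window_add, phi_append]

theorem phiPos_succ (m : ℕ) : phiPos (m + 1) = phiPos m + (phiLetter (fixedPt m)).length := by
  rw [phiPos_add, window_one, phi_singleton]

theorem phi_window (m n : ℕ) :
    phi (window fixedPt m n) =
      window fixedPt (phiPos m) (phi (window fixedPt m n)).length := by
  have h := phi_window_isPrefixOf (m + n)
  rw [window_add, phi_append] at h
  simpa [phiPos] using (eq_window_of_append h).2

theorem le_phiPos (m : ℕ) : 3 * m ≤ phiPos m := by
  simpa [phiPos] using length_phi (window fixedPt 0 m)

theorem phi_mem_language {w : List (Fin 4)} (hw : w ∈ language fixedPt) :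
    phi w ∈ language fixedPt := by
  obtain ⟨k, n, rfl⟩ := mem_language_iff.1 hw
  exact mem_language_iff.2 ⟨_, _, phi_window k n⟩

theorem exists_phiPos_le (k : ℕ) :
    ∃ m, phiPos m ≤ k ∧ k < phiPos (m + 1) := by
  have hex : ∃ m, k < phiPos (m + 1) := ⟨k, by have := le_phiPos (k + 1); omega⟩
  classical
  refine ⟨Nat.find hex, ?_, Nat.find_spec hex⟩
  rcases hm : Nat.find hex with _ | m
  · simp [phiPos_zero]
  · exact not_lt.1 (Nat.find_min hex (m := m) (by omega))

theorem phiPos_mono : Monotone phiPos :=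
  monotone_nat_of_le_succ fun m => by rw [phiPos_succ]; omega

theorem length_phiLetter_le (a : Fin 4) : (phiLetter a).length ≤ 4 := by
  fin_cases a <;> decide

/-- Every factor is, up to short ends, the image of a shorter factor. -/
theorem exists_desubstitution {v : List (Fin 4)} (hv : v ∈ language fixedPt) :
    ∃ p w t, v = p ++ phi w ++ t ∧ w ∈ language fixedPt ∧ p.length ≤ 4 ∧ t.length ≤ 4 := by
  obtain ⟨k, n, rfl⟩ := mem_language_iff.1 hv
  obtain ⟨m₁, h1, h2⟩ := exists_phiPos_le k
  obtain ⟨m₂, h3, h4⟩ := exists_phiPos_le (k + n)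
  have e1 := phiPos_succ m₁
  have e2 := phiPos_succ m₂
  have l1 := length_phiLetter_le (fixedPt m₁)
  have l2 := length_phiLetter_le (fixedPt m₂)
  -- The ends of the factor lie in the blocks `m₁` and `m₂`. If these differ, the complete blocks
  -- strictly between them form the image; otherwise the factor fits in one block and the middle
  -- word can be empty.
  rcases Nat.lt_or_ge m₁ m₂ with h | h
  · obtain ⟨d, rfl⟩ := Nat.exists_eq_add_of_le (Nat.succ_le_of_lt h)
    rw [Nat.succ_eq_add_one] at *
    have e3 := phiPos_add (m₁ + 1) d
    refine ⟨window fixedPt k (phiPos (m₁ + 1) - k), window fixedPt (m₁ + 1) d,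
      window fixedPt (phiPos (m₁ + 1 + d)) (k + n - phiPos (m₁ + 1 + d)), ?_,
      window_mem_language _ _ _, by simp; omega, by simp; omega⟩
    rw [phi_window]
    have a1 : phiPos (m₁ + 1) = k + (phiPos (m₁ + 1) - k) := by omega
    have a2 : phiPos (m₁ + 1 + d) =
      k + (phiPos (m₁ + 1) - k + (phi (window fixedPt (m₁ + 1) d)).length) := by omega
    conv_rhs =>
      enter [1, 2, 2]
      rw [a1]
    rw [← window_add]
    conv_rhs =>
      enter [2, 2]
      rw [a2]
    rw [← window_add]
    congr 1
    omega
  · have := phiPos_mono (Nat.succ_le_succ h)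
    simp only [Nat.succ_eq_add_one] at this
    exact ⟨window fixedPt k n, [], [], by simp [phi_nil], window_mem_language _ 0 0,
      by simp; omega, by simp⟩

/-! ### Adjacent letters and the coding by kind -/

/-- The pairs of letters that may be neighbours in `fixedPt`. -/
def Adj (a b : Fin 4) : Prop :=
  (a, b) ∈ [((0 : Fin 4), (1 : Fin 4)), (0, 2), (1, 0), (1, 3), (2, 1), (3, 0)]

instance : DecidableRel Adj := fun a b => by unfold Adj; infer_instance

/-- Whether a letter is one of `2`, `3`. -/
def kind (a : Fin 4) : Bool := decide (2 ≤ a)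

/-- The action of `theta1 * theta2` on letters. -/
def flip : Fin 4 → Fin 4 := ![1, 0, 3, 2]

/-- Together with `Adj.eq_left` this makes the coding by `kind` faithful up to the choice of one
letter. -/
theorem Adj.eq_right : ∀ {a b c : Fin 4}, Adj a b → Adj a c → kind b = kind c → b = c := by
  decide

theorem Adj.eq_left : ∀ {a b c : Fin 4}, Adj b a → Adj c a → kind b = kind c → b = c := by
  decide

theorem kind_flip : ∀ a, kind (flip a) = kind a := by decide

theorem flip_ne : ∀ a, flip a ≠ a := by decide

theorem flip_flip : ∀ a, flip (flip a) = a := by decide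

theorem phi_isChain {w : List (Fin 4)} (h : w.IsChain Adj) : (phi w).IsChain Adj := by
  have h1 : ∀ a, (phiLetter a).IsChain Adj := by decide
  have h2 : ∀ a b, Adj a b →
      ∀ x ∈ (phiLetter a).getLast?, ∀ y ∈ (phiLetter b).head?, Adj x y := by decide
  have h3 : ∀ a, phiLetter a ≠ [] := by decide
  induction w with
  | nil => simp [phi_nil]
  | cons a w ih =>
    cases w with
    | nil => rw [phi_singleton]; exact h1 a
    | cons b w =>
      rw [List.isChain_cons_cons] at h
      rw [phi_cons, List.isChain_append]
      refine ⟨h1 a, ih h.2, ?_⟩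
      rw [phi_cons, List.head?_append_of_ne_nil _ (h3 b)]
      exact h2 a b h.1

theorem isChain_of_mem_language {w : List (Fin 4)} (hw : w ∈ language fixedPt) :
    w.IsChain Adj := by
  have h : ∀ n, (phi^[n] [0]).IsChain Adj := by
    intro n
    induction n with
    | zero => simp
    | succ n ih => rw [Function.iterate_succ_apply']; exact phi_isChain ih
  obtain ⟨k, n, rfl⟩ := mem_language_iff.1 hw
  refine (h (k + n)).infix (List.IsInfix.trans ?_ (window_prefix_iterate le_rfl).isInfix)
  rw [window_add, zero_add]
  exact ⟨_, [], by simp; rfl⟩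

theorem adj_fixedPt (i : ℕ) : Adj (fixedPt i) (fixedPt (i + 1)) := by
  have h := isChain_of_mem_language (window_mem_language fixedPt i 2)
  rw [window_succ, window_one] at h
  simpa using h

theorem exists_infix_iterate {w : List (Fin 4)} (hw : w ∈ language fixedPt) :
    ∃ n, w <:+: phi^[n] [0] := by
  obtain ⟨k, n, rfl⟩ := mem_language_iff.1 hw
  refine ⟨k + n, List.IsInfix.trans ?_ (window_prefix_iterate le_rfl).isInfix⟩
  rw [window_add, zero_add]
  exact ⟨_, [], by simp; rfl⟩

/-! ### Uniform recurrence -/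

theorem isUniformlyRecurrent_fixedPt : IsUniformlyRecurrent fixedPt := by
  have key : ∀ n, ∃ R : ℕ, ∀ i, ∃ j, i ≤ j ∧ j ≤ i + R ∧
      phi^[n] [0] = window fixedPt j (phi^[n] [0]).length := by
    intro n
    induction n with
    | zero =>
      refine ⟨3, fun i => ?_⟩
      -- The longest admissible word without 0 is 213.
      have h : ∀ a b c d, Adj a b → Adj b c → Adj c d → a = 0 ∨ b = 0 ∨ c = 0 ∨ d = 0 := by
        decide
      rcases h _ _ _ _ (adj_fixedPt i) (adj_fixedPt (i + 1)) (adj_fixedPt (i + 1 + 1)) with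
        h | h | h | h
      · exact ⟨i, by omega, by omega, by simp [window_one, h]⟩
      · exact ⟨i + 1, by omega, by omega, by simp [window_one, h]⟩
      · exact ⟨i + 1 + 1, by omega, by omega, by simp [window_one, h]⟩
      · exact ⟨i + 1 + 1 + 1, by omega, by omega, by simp [window_one, h]⟩
    | succ n ih =>
      obtain ⟨R, hR⟩ := ih
      -- Images have length at most 4: the next block boundary costs at most 4, and a gap of R
      -- blocks at most 4R.
      refine ⟨4 * R + 4, fun i => ?_⟩
      obtain ⟨m, hm1, hm2⟩ := exists_phiPos_le i
      obtain ⟨j, hj1, hj2, hj⟩ := hR (m + 1)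
      obtain ⟨d, rfl⟩ := Nat.exists_eq_add_of_le hj1
      have e1 := phiPos_succ m
      have e2 := phiPos_add (m + 1) d
      have e3 := length_phi_le (window fixedPt (m + 1) d)
      have e4 := length_phiLetter_le (fixedPt m)
      rw [length_window] at e3
      refine ⟨phiPos (m + 1 + d), by omega, by omega, ?_⟩
      rw [Function.iterate_succ_apply', hj]
      exact phi_window _ _
  intro w hw
  obtain ⟨n, s, t, hst⟩ := exists_infix_iterate hw
  obtain ⟨R, hR⟩ := key n
  refine ⟨R + s.length, fun i => ?_⟩
  obtain ⟨j, h1, h2, h3⟩ := hR i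
  refine ⟨j + s.length, by omega, by omega, ?_⟩
  rw [← hst, List.append_assoc] at h3
  exact (eq_window_of_append (eq_window_of_append h3).2).1

/-- The occurrence at index 0 may have no predecessor, but recurrence supplies a later one. -/
theorem lext_nonempty {w : List (Fin 4)} (hw : w ∈ language fixedPt) :
    (lext fixedPt w).Nonempty := by
  obtain ⟨R, hR⟩ := isUniformlyRecurrent_fixedPt w hw
  obtain ⟨j, h1, -, h3⟩ := hR 1
  obtain ⟨j, rfl⟩ := Nat.exists_eq_add_of_le' h1
  refine ⟨fixedPt j, j, ?_⟩
  rw [List.length_cons, window_succ', ← h3]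

/-! ### Symmetries -/

theorem theta1_apply (w : List (Fin 4)) : theta1 w = (w.map (Equiv.swap 0 1)).reverse := rfl

theorem theta2_apply (w : List (Fin 4)) : theta2 w = (w.map (Equiv.swap 2 3)).reverse := rfl

theorem theta12_apply (w : List (Fin 4)) : (theta1 * theta2) w = w.map flip := by
  rw [theta1, theta2, antimorph_mul]
  congr 1
  funext a
  revert a
  decide

theorem theta2_append (v w : List (Fin 4)) : theta2 (v ++ w) = theta2 w ++ theta2 v := by
  simp [theta2_apply]

theorem theta1_append (v w : List (Fin 4)) : theta1 (v ++ w) = theta1 w ++ theta1 v := by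
  simp [theta1_apply]

theorem theta2_theta2 (w : List (Fin 4)) : theta2 (theta2 w) = w :=
  congrArg (fun f => f w) theta2_sq

theorem theta1_theta1 (w : List (Fin 4)) : theta1 (theta1 w) = w :=
  congrArg (fun f => f w) theta1_sq

theorem theta1_eq (w : List (Fin 4)) : theta1 w = (theta2 w).map flip := by
  rw [← theta12_apply, Equiv.Perm.mul_apply, theta2_theta2]

/-- The word by which `phi` and its conjugate by `theta2` are conjugate, depending on the letter
that follows. -/
def conjWord : Fin 4 → List (Fin 4) :=
  ![[0, 1, 3, 0, 1], [1, 0, 2, 1, 0], [1, 0, 2, 1, 0], [0, 1, 3, 0, 1]]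

/-- `phi` and its conjugate by `theta2` differ by a conjugation on admissible words. The identity
for a single letter and its successor is a finite check, and it telescopes along the chain. -/
theorem phi_append_conjWord (w : List (Fin 4)) (a : Fin 4) (h : (w ++ [a]).IsChain Adj) :
    phi w ++ conjWord a = conjWord ((w ++ [a]).head (by simp)) ++ theta2 (phi (theta2 w)) := by
  have h1 : ∀ a b, Adj a b → phiLetter a ++ conjWord b =
      conjWord a ++ theta2 (phi (theta2 [a])) := by decide
  induction w with
  | nil => simp [phi_nil, theta2_apply]
  | cons b w ih =>
    rw [List.cons_append, List.isChain_cons] at h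
    have hb : Adj b ((w ++ [a]).head (by simp)) := h.1 _ (by simp [List.head?_eq_some_head])
    have e : theta2 (phi (theta2 (b :: w))) =
        theta2 (phi (theta2 [b])) ++ theta2 (phi (theta2 w)) := by
      rw [← List.singleton_append, theta2_append, phi_append, theta2_append]
    rw [phi_cons, List.append_assoc, ih h.2, ← List.append_assoc, h1 _ _ hb, e]
    simp

theorem theta2_mem_language {w : List (Fin 4)} (hw : w ∈ language fixedPt) :
    theta2 w ∈ language fixedPt := by
  have step : ∀ v, theta2 v ∈ language fixedPt → theta2 (phi v) ∈ language fixedPt := by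
    intro v hv
    obtain ⟨a, ha⟩ := rext_nonempty hv
    have ha' : theta2 v ++ [a] ∈ language fixedPt := ha
    obtain ⟨b, hb⟩ := rext_nonempty ha'
    have hb' : theta2 v ++ [a] ++ [b] ∈ language fixedPt := hb
    have hc := phi_append_conjWord _ _ (isChain_of_mem_language ha')
    rw [theta2_theta2] at hc
    have hab : Adj a b := by
      have := isChain_of_mem_language hb'
      rw [List.append_assoc, List.isChain_append] at this
      simpa using this.2.1
    -- A conjugating word has length 5 and overruns the image of one letter, hence the extension by
    -- two letters.
    have hz : ∀ a b, Adj a b → conjWord a <+: phi [a, b] := by decide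
    obtain ⟨t, ht⟩ := hz a b hab
    have hm := phi_mem_language hb'
    rw [List.append_assoc, phi_append, List.singleton_append, ← ht, ← List.append_assoc,
      hc] at hm
    exact mem_language_of_infix ⟨_, _, rfl⟩ hm
  have h : ∀ n, theta2 (phi^[n] [0]) ∈ language fixedPt := by
    intro n
    induction n with
    | zero => exact phi_iterate_mem_language 0
    | succ n ih => rw [Function.iterate_succ_apply']; exact step _ ih
  obtain ⟨n, s, t, hst⟩ := exists_infix_iterate hw
  have hn := h n
  rw [← hst, theta2_append, theta2_append] at hn
  exact mem_language_of_infix ⟨theta2 t, theta2 s, by simp⟩ hn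

theorem phi_map_flip (w : List (Fin 4)) : phi (w.map flip) = (phi w).map flip := by
  have h : ∀ a, phiLetter (flip a) = (phiLetter a).map flip := by decide
  induction w with
  | nil => rfl
  | cons a w ih => rw [List.map_cons, phi_cons, phi_cons, List.map_append, ih, h]

theorem map_flip_mem_language {w : List (Fin 4)} (hw : w ∈ language fixedPt) :
    w.map flip ∈ language fixedPt := by
  have h : ∀ n, (phi^[n] [0]).map flip ∈ language fixedPt := by
    intro n
    induction n with
    | zero => exact mem_language_of_infix (by decide) (phi_iterate_mem_language 1)
    | succ n ih =>
      rw [Function.iterate_succ_apply', ← phi_map_flip]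
      exact phi_mem_language ih
  obtain ⟨n, hn⟩ := exists_infix_iterate hw
  exact mem_language_of_infix (hn.map flip) (h n)

theorem theta1_mem_language {w : List (Fin 4)} (hw : w ∈ language fixedPt) :
    theta1 w ∈ language fixedPt := by
  rw [theta1_eq]
  exact map_flip_mem_language (theta2_mem_language hw)

theorem map_flip_map_flip (w : List (Fin 4)) : (w.map flip).map flip = w := by
  simp [Function.comp_def, flip_flip]

/-! ### Balance -/

/-- The frequency of the letters `2`, `3`. -/
noncomputable def slope : ℝ := 2 - √3

theorem slope_sq : slope * slope = 4 * slope - 1 := by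
  have h : √3 * √3 = (3 : ℝ) := Real.mul_self_sqrt (by norm_num)
  unfold slope
  linear_combination h

theorem slope_bounds : 0.26 < slope ∧ slope < 0.27 := by
  have h1 : (1.73 : ℝ) < √3 := Real.lt_sqrt_of_sq_lt (by norm_num)
  have h2 : √3 < (1.74 : ℝ) := (Real.sqrt_lt' (by norm_num)).2 (by norm_num)
  unfold slope
  constructor <;> linarith

theorem irrational_slope : Irrational slope := by
  have h : Irrational √(3 : ℝ) := by
    have := Nat.Prime.irrational_sqrt Nat.prime_three
    exact_mod_cast this
  exact_mod_cast h.ratCast_sub 2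

/-- The number of letters `2`, `3` in a word. -/
def kindCount (w : List (Fin 4)) : ℕ := w.countP kind

theorem kindCount_append (v w : List (Fin 4)) :
    kindCount (v ++ w) = kindCount v + kindCount w := List.countP_append

/-- With `length_phi_add_kindCount`, `phi` acts on (length, number of letters 2 and 3) by (L, K) ↦
(4L - K, L), whose eigendirection K = sL gives the slope. -/
theorem kindCount_phi (w : List (Fin 4)) : kindCount (phi w) = w.length := by
  have h : ∀ a, kindCount (phiLetter a) = 1 := by decide
  induction w with
  | nil => rfl
  | cons a w ih => rw [phi_cons, kindCount_append, ih, h, List.length_cons, add_comm]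

theorem length_phi_add_kindCount (w : List (Fin 4)) :
    (phi w).length + kindCount w = 4 * w.length := by
  have h : ∀ a, (phiLetter a).length + kindCount [a] = 4 := by decide
  induction w with
  | nil => rfl
  | cons a w ih =>
    have := h a
    rw [phi_cons, ← List.singleton_append, kindCount_append, List.length_append,
      List.length_append, List.length_singleton]
    omega

/-- Write m as a block boundary `phiPos k` plus r < 4, and let D(m) be the quantity to be bounded.
Then D(m) = s·D(k) + 1 - (3 - r)s - [r = 3]. Since 0 < s·D(k) < s, the cases r = 0, 1, 2, 3 all stay
inside (0,1). -/
theorem prefix_discrepancy (m : ℕ) :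
    0 < (m + 1) * slope - kindCount (window fixedPt 0 m) ∧
      (m + 1) * slope - kindCount (window fixedPt 0 m) < 1 := by
  obtain ⟨b1, b2⟩ := slope_bounds
  -- The letter 2 or 3 of a block is its third, so a proper prefix of a block contains it only when
  -- it has length 3.
  have hl : ∀ a : Fin 4, ∀ r < (phiLetter a).length,
      kindCount ((phiLetter a).take r) = if r = 3 then 1 else 0 := by decide
  induction m using Nat.strong_induction_on with
  | _ m ih =>
    rcases Nat.eq_zero_or_pos m with rfl | hm
    · norm_num [window_zero, kindCount]
      constructor <;> linarith
    obtain ⟨k, h1, h2⟩ := exists_phiPos_le m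
    have hk := le_phiPos k
    obtain ⟨f1, f2⟩ := ih k (by omega)
    obtain ⟨r, rfl⟩ := Nat.exists_eq_add_of_le h1
    rw [phiPos_succ] at h2
    have hr : r < (phiLetter (fixedPt k)).length := by omega
    have hr4 := length_phiLetter_le (fixedPt k)
    have e0 := phi_window_isPrefixOf k
    have e1 : window fixedPt (phiPos k) r = (phiLetter (fixedPt k)).take r := by
      have := phi_window k 1
      rw [window_one, phi_singleton] at this
      obtain ⟨d, hd⟩ := Nat.exists_eq_add_of_le hr.le
      rw [hd, window_add] at this
      rw [this, List.take_left' (by simp)]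
    have e2 : kindCount (window fixedPt 0 (phiPos k + r)) = k + if r = 3 then 1 else 0 := by
      rw [window_add, zero_add, kindCount_append, e1, hl _ _ hr]
      rw [IsPrefixOf] at e0
      rw [phiPos, ← e0, kindCount_phi, length_window]
    have e3 : (phiPos k : ℝ) + kindCount (window fixedPt 0 k) = 4 * k := by
      have := length_phi_add_kindCount (window fixedPt 0 k)
      rw [length_window] at this
      exact_mod_cast this
    rw [e2]
    set D : ℝ := ((kindCount (window fixedPt 0 k) : ℕ) : ℝ)
    have e4 : (phiPos k : ℝ) * slope - k =
        ((k + 1) * slope - D) * slope + (1 - 4 * slope) := by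
      linear_combination slope * e3 - (k + 1) * slope_sq
    have g1 : 0 < ((k + 1) * slope - D) * slope := mul_pos f1 (by linarith)
    have g2 : ((k + 1) * slope - D) * slope < slope := by nlinarith
    have hr3 : r < 4 := by omega
    interval_cases r <;> push_cast <;> constructor <;> norm_num <;> nlinarith

/-- A factor is a difference of two prefixes, whose discrepancies both lie in (0,1). -/
theorem discrepancy {w : List (Fin 4)} (hw : w ∈ language fixedPt) :
    |(kindCount w : ℝ) - w.length * slope| < 1 := by
  obtain ⟨k, n, rfl⟩ := mem_language_iff.1 hw
  obtain ⟨h1, h2⟩ := prefix_discrepancy k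
  obtain ⟨h3, h4⟩ := prefix_discrepancy (k + n)
  rw [window_add, kindCount_append, zero_add] at h3 h4
  push_cast at h3 h4
  rw [length_window, abs_lt]
  constructor <;> linarith

theorem balanced {v w : List (Fin 4)} (hv : v ∈ language fixedPt) (hw : w ∈ language fixedPt)
    (h : v.length = w.length) : kindCount v ≤ kindCount w + 1 := by
  have h1 := abs_lt.1 (discrepancy hv)
  have h2 := abs_lt.1 (discrepancy hw)
  rw [h] at h1
  have : (kindCount v : ℝ) < kindCount w + 2 := by linarith [h1.2, h2.1]
  have : kindCount v < kindCount w + 2 := by exact_mod_cast this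
  omega

theorem isAperiodic_fixedPt : IsAperiodic fixedPt := by
  rintro ⟨p, hp, N, h⟩
  have h1 : ∀ i, window fixedPt (N + i * p) p = window fixedPt N p := by
    intro i
    induction i with
    | zero => simp
    | succ i ih =>
      rw [← ih]
      refine List.map_congr_left fun j _ => ?_
      rw [← h (N + i * p + j) (by omega),
        show N + (i + 1) * p + j = N + i * p + j + p by ring]
  have h2 : ∀ i, kindCount (window fixedPt N (i * p)) = i * kindCount (window fixedPt N p) := by
    intro i
    induction i with
    | zero => simp [window_zero, kindCount]
    | succ i ih => rw [Nat.succ_mul, window_add, kindCount_append, ih, h1]; ring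
  set c := kindCount (window fixedPt N p)
  -- Repeating a period multiplies its discrepancy, which stays bounded; so it vanishes and the
  -- slope would be c/p.
  have h3 : ∀ i : ℕ, i * |(c : ℝ) - p * slope| < 1 := by
    intro i
    have := discrepancy (window_mem_language fixedPt N (i * p))
    rw [h2, length_window] at this
    rw [← Nat.abs_cast i, ← abs_mul]
    have e : (i : ℝ) * (c - p * slope) = ((i * c : ℕ) : ℝ) - ((i * p : ℕ) : ℝ) * slope := by
      push_cast
      ring
    rwa [e]
  have h4 : (c : ℝ) - p * slope = 0 := by
    by_contra hne
    obtain ⟨i, hi⟩ := exists_nat_gt (1 / |(c : ℝ) - p * slope|)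
    rw [div_lt_iff₀ (abs_pos.2 hne)] at hi
    exact lt_asymm hi (h3 i)
  refine irrational_slope ⟨(c : ℚ) / p, ?_⟩
  have hp' : (p : ℝ) ≠ 0 := by positivity
  push_cast
  field_simp
  linarith

/-! ### Special factors -/

/-- A factor with at least two right extensions. -/
def IsRightSpecial (w : List (Fin 4)) : Prop :=
  ∃ a b, w ++ [a] ∈ language fixedPt ∧ w ++ [b] ∈ language fixedPt ∧ a ≠ b

/-- A factor with at least two left extensions. -/
def IsLeftSpecial (w : List (Fin 4)) : Prop :=
  ∃ a b, a :: w ∈ language fixedPt ∧ b :: w ∈ language fixedPt ∧ a ≠ b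

theorem isRightSpecial_iff {w : List (Fin 4)} :
    IsRightSpecial w ↔ 2 ≤ (rext fixedPt w).ncard := by
  exact (Set.one_lt_ncard_iff (Set.toFinite _)).symm

theorem isLeftSpecial_iff {w : List (Fin 4)} :
    IsLeftSpecial w ↔ 2 ≤ (lext fixedPt w).ncard := by
  exact (Set.one_lt_ncard_iff (Set.toFinite _)).symm

theorem mem_language_left {v w : List (Fin 4)} (h : v ++ w ∈ language fixedPt) :
    v ∈ language fixedPt := mem_language_of_infix (List.prefix_append v w).isInfix h

theorem mem_language_right {v w : List (Fin 4)} (h : v ++ w ∈ language fixedPt) :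
    w ∈ language fixedPt := mem_language_of_infix (List.suffix_append v w).isInfix h

theorem IsRightSpecial.mem_language {w : List (Fin 4)} (h : IsRightSpecial w) :
    w ∈ language fixedPt := by
  obtain ⟨a, b, ha, -⟩ := h
  exact mem_language_left ha

theorem IsLeftSpecial.mem_language {w : List (Fin 4)} (h : IsLeftSpecial w) :
    w ∈ language fixedPt := by
  obtain ⟨a, b, ha, -⟩ := h
  exact mem_language_right (v := [a]) ha

theorem isBispecial_iff {w : List (Fin 4)} :
    IsBispecial fixedPt w ↔ IsLeftSpecial w ∧ IsRightSpecial w := by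
  rw [IsBispecial, ← isRightSpecial_iff, ← isLeftSpecial_iff]
  exact ⟨fun h => h.2, fun h => ⟨h.1.mem_language, h⟩⟩

theorem adj_of_mem_language {w : List (Fin 4)} {a b : Fin 4}
    (h : w ++ [a] ++ [b] ∈ language fixedPt) : Adj a b := by
  have := isChain_of_mem_language h
  rw [List.append_assoc, List.isChain_append] at this
  simpa using this.2.1

/-- Two right extensions of the same kind coincide. -/
theorem eq_of_kind_eq {w : List (Fin 4)} (hw : w ≠ []) {a b : Fin 4}
    (ha : w ++ [a] ∈ language fixedPt) (hb : w ++ [b] ∈ language fixedPt)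
    (h : kind a = kind b) : a = b := by
  obtain ⟨v, c, rfl⟩ := List.eq_nil_or_concat'  w |>.resolve_left hw
  exact (adj_of_mem_language ha).eq_right (adj_of_mem_language hb) h

theorem rext_eq_pair {w : List (Fin 4)} (hw : w ≠ []) {a b : Fin 4}
    (ha : w ++ [a] ∈ language fixedPt) (hb : w ++ [b] ∈ language fixedPt) (hab : a ≠ b) :
    rext fixedPt w = {a, b} := by
  ext c
  simp only [rext, Set.mem_ofPred_eq, Set.mem_insert_iff, Set.mem_singleton_iff]
  refine ⟨fun hc => ?_, by rintro (rfl | rfl) <;> assumption⟩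
  have h1 : kind a ≠ kind b := fun h => hab (eq_of_kind_eq hw ha hb h)
  by_cases h : kind c = kind a
  · exact Or.inl (eq_of_kind_eq hw hc ha h)
  · refine Or.inr (eq_of_kind_eq hw hc hb ?_)
    revert h h1
    generalize kind a = x
    generalize kind b = y
    generalize kind c = z
    revert x y z
    decide

theorem isRightSpecial_map_flip {w : List (Fin 4)} (h : IsRightSpecial w) :
    IsRightSpecial (w.map flip) := by
  obtain ⟨a, b, ha, hb, hab⟩ := h
  refine ⟨flip a, flip b, ?_, ?_, fun h => hab ?_⟩
  · simpa using map_flip_mem_language ha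
  · simpa using map_flip_mem_language hb
  · rw [← flip_flip a, h, flip_flip]

theorem isLeftSpecial_map_flip {w : List (Fin 4)} (h : IsLeftSpecial w) :
    IsLeftSpecial (w.map flip) := by
  obtain ⟨a, b, ha, hb, hab⟩ := h
  refine ⟨flip a, flip b, ?_, ?_, fun h => hab ?_⟩
  · simpa using map_flip_mem_language ha
  · simpa using map_flip_mem_language hb
  · rw [← flip_flip a, h, flip_flip]

theorem IsRightSpecial.theta1 {w : List (Fin 4)} (h : IsRightSpecial w) :
    IsLeftSpecial (theta1 w) := by
  obtain ⟨a, b, ha, hb, hab⟩ := h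
  refine ⟨Equiv.swap 0 1 a, Equiv.swap 0 1 b, ?_, ?_, by simpa using hab⟩
  · simpa [theta1_apply] using theta1_mem_language ha
  · simpa [theta1_apply] using theta1_mem_language hb

theorem IsLeftSpecial.theta1 {w : List (Fin 4)} (h : IsLeftSpecial w) :
    IsRightSpecial (theta1 w) := by
  obtain ⟨a, b, ha, hb, hab⟩ := h
  refine ⟨Equiv.swap 0 1 a, Equiv.swap 0 1 b, ?_, ?_, by simpa using hab⟩
  · simpa [theta1_apply] using theta1_mem_language ha
  · simpa [theta1_apply] using theta1_mem_language hb

theorem kindCount_of_map_eq {v w : List (Fin 4)} (h : v.map kind = w.map kind) :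
    kindCount v = kindCount w := by
  have e : ∀ x : List (Fin 4), kindCount x = (x.map kind).countP id := fun x => by
    simp [kindCount, List.countP_map]
  rw [e, e, h]

/-- Two words of the same length that project differently have suffixes that project to words
which differ exactly at the first letter. -/
theorem exists_suffix_of_map_ne : ∀ {v w : List (Fin 4)}, v.length = w.length →
    v.map kind ≠ w.map kind → ∃ p q a b s t, v = p ++ a :: s ∧ w = q ++ b :: t ∧
      kind a ≠ kind b ∧ s.map kind = t.map kind
  | [], [], _, h => absurd rfl h
  | a :: s, b :: t, hl, h => by
    by_cases hst : s.map kind = t.map kind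
    · refine ⟨[], [], a, b, s, t, rfl, rfl, fun hab => h ?_, hst⟩
      rw [List.map_cons, List.map_cons, hst, hab]
    · obtain ⟨p, q, c, d, s', t', rfl, rfl, h1, h2⟩ :=
        exists_suffix_of_map_ne (by simpa using hl) hst
      exact ⟨a :: p, b :: q, c, d, s', t', rfl, rfl, h1, h2⟩

/-- A chain is determined by its projection and its last letter. -/
theorem eq_of_map_kind_eq : ∀ {v w : List (Fin 4)} {a : Fin 4}, (v ++ [a]).IsChain Adj →
    (w ++ [a]).IsChain Adj → v.map kind = w.map kind → v = w
  | [], [], _, _, _, _ => rfl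
  | [], _ :: _, _, _, _, h => by simp at h
  | _ :: _, [], _, _, _, h => by simp at h
  | b :: v, c :: w, a, hv, hw, h => by
    rw [List.map_cons, List.map_cons, List.cons.injEq] at h
    rw [List.cons_append, List.isChain_cons] at hv hw
    obtain rfl := eq_of_map_kind_eq hv.2 hw.2 h.2
    have hh := List.head?_eq_some_head (l := v ++ [a]) (by simp)
    rw [(hv.1 _ hh).eq_left (hw.1 _ hh) h.1]

theorem exists_rext_of_kind {w : List (Fin 4)} (hw : w ≠ []) (h : IsRightSpecial w) (x : Bool) :
    ∃ a, w ++ [a] ∈ language fixedPt ∧ kind a = x := by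
  obtain ⟨a, b, ha, hb, hab⟩ := h
  by_cases hx : kind a = x
  · exact ⟨a, ha, hx⟩
  · refine ⟨b, hb, ?_⟩
    have h1 : kind a ≠ kind b := fun h => hab (eq_of_kind_eq hw ha hb h)
    revert h1 hx
    generalize kind a = x
    generalize kind b = y
    revert x y
    revert x
    decide

/-- Right special factors of the same length agree up to `theta1 * theta2`. -/
theorem IsRightSpecial.eq_or_eq {v w : List (Fin 4)} (hv : IsRightSpecial v)
    (hw : IsRightSpecial w) (hl : v.length = w.length) (hne : v ≠ []) :
    v = w ∨ v = w.map flip := by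
  have hne' : w ≠ [] := by rintro rfl; exact hne (List.length_eq_zero_iff.1 hl)
  have hmap : v.map kind = w.map kind := by
    by_contra h
    obtain ⟨p, q, a, b, s, t, e1, e2, hab, hst⟩ := exists_suffix_of_map_ne hl h
    -- If the codings differ, cut after the last difference. Extending the word with the letter 2 or
    -- 3 there by another such letter, and the other word by 0 or 1, gives equally long factors
    -- whose counts differ by 2, against balance.
    have key : ∀ {v w p q : List (Fin 4)} {a b s t}, IsRightSpecial v → IsRightSpecial w →
        v = p ++ a :: s → w = q ++ b :: t → kind a = true → kind b = false →
        s.map kind = t.map kind → False := by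
      intro v w p q a b s t hv hw e1 e2 ha hb hst
      obtain ⟨c, hc, hc'⟩ := exists_rext_of_kind (by simp [e1]) hv true
      obtain ⟨d, hd, hd'⟩ := exists_rext_of_kind (by simp [e2]) hw false
      rw [e1, List.append_assoc] at hc
      rw [e2, List.append_assoc] at hd
      have hlen : s.length = t.length := by simpa using congrArg List.length hst
      have hbal := balanced (mem_language_right hc) (mem_language_right hd) (by simp [hlen])
      have e := kindCount_of_map_eq hst
      have f : ∀ x y z, kindCount ((x :: y) ++ [z]) = kindCount [x] + kindCount y + kindCount [z] :=
        fun x y z => by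
          rw [kindCount_append, ← List.singleton_append, kindCount_append]
      rw [f, f, e] at hbal
      simp [kindCount, ha, hb, hc', hd'] at hbal
    cases ha : kind a with
    | true =>
      refine key hv hw e1 e2 ha ?_ hst
      rw [ha] at hab; simpa using hab.symm
    | false =>
      refine key hw hv e2 e1 ?_ ha hst.symm
      rw [ha] at hab; simpa using hab.symm
  obtain ⟨a, ha, hak⟩ := exists_rext_of_kind hne hv false
  obtain ⟨b, hb, hbk⟩ := exists_rext_of_kind hne' hw false
  -- Both words extend by 0 or 1; the extending letters agree or are exchanged by `flip`, and
  -- reading leftwards from them determines the words.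
  have hcases : ∀ a b, kind a = false → kind b = false → a = b ∨ a = flip b := by decide
  rcases hcases a b hak hbk with rfl | rfl
  · exact Or.inl (eq_of_map_kind_eq (isChain_of_mem_language ha) (isChain_of_mem_language hb) hmap)
  · refine Or.inr (eq_of_map_kind_eq (isChain_of_mem_language ha) ?_ (hmap.trans ?_))
    · simpa using isChain_of_mem_language (map_flip_mem_language hb)
    · simp [Function.comp_def, kind_flip]

theorem map_flip_ne {w : List (Fin 4)} (hne : w ≠ []) : w.map flip ≠ w := by
  cases w with
  | nil => exact absurd rfl hne
  | cons a w => simp [flip_ne]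

theorem theta1_ne_nil {w : List (Fin 4)} (hne : w ≠ []) : theta1 w ≠ [] := by
  simpa [theta1_apply] using hne

theorem length_theta1 (w : List (Fin 4)) : (theta1 w).length = w.length := by
  simp [theta1_apply]

theorem theta1_map_flip (w : List (Fin 4)) : theta1 (w.map flip) = (theta1 w).map flip := by
  have h : ∀ a, Equiv.swap 0 1 (flip a) = flip (Equiv.swap 0 1 a) := by decide
  simp [theta1_apply, h]

theorem IsLeftSpecial.eq_or_eq {v w : List (Fin 4)} (hv : IsLeftSpecial v)
    (hw : IsLeftSpecial w) (hl : v.length = w.length) (hne : v ≠ []) :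
    v = w ∨ v = w.map flip := by
  have := hv.theta1.eq_or_eq hw.theta1 (by simpa [length_theta1] using hl) (theta1_ne_nil hne)
  rw [← theta1_map_flip] at this
  exact this.imp (fun h => SymWord.theta1.injective h) fun h => SymWord.theta1.injective h

/-- Otherwise each window of length n determines the next letter; two equal windows exist by
pigeonhole, and the word would be eventually periodic. -/
theorem exists_isRightSpecial (n : ℕ) : ∃ w, w.length = n ∧ IsRightSpecial w := by
  by_contra! hno
  have hfin : Finite {w : List (Fin 4) // w.length = n} := List.finite_length_eq (Fin 4) n
  obtain ⟨k, l, hkl, he⟩ := Finite.exists_ne_map_eq_of_infinite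
    fun k : ℕ => (⟨window fixedPt k n, by simp⟩ : {w : List (Fin 4) // w.length = n})
  replace he : window fixedPt k n = window fixedPt l n := congrArg Subtype.val he
  have main : ∀ k l, k < l → window fixedPt k n = window fixedPt l n → False := by
    intro k l hkl he
    have step : ∀ i, window fixedPt (k + i) n = window fixedPt (l + i) n := by
      intro i
      induction i with
      | zero => exact he
      | succ i ih =>
        have h1 := window_mem_language fixedPt (k + i) (n + 1)
        have h2 := window_mem_language fixedPt (l + i) (n + 1)
        have hlast : fixedPt (k + i + n) = fixedPt (l + i + n) := by
          by_contra hne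
          rw [window_succ] at h1 h2
          rw [← ih] at h2
          exact hno _ (by simp) ⟨_, _, h1, h2, hne⟩
        have : window fixedPt (k + i) (n + 1) = window fixedPt (l + i) (n + 1) := by
          rw [window_succ, window_succ, ih, hlast]
        rw [window_succ', window_succ'] at this
        exact (List.cons.inj this).2
    refine isAperiodic_fixedPt ⟨l - k, by omega, k + n, fun i hi => ?_⟩
    obtain ⟨j, rfl⟩ := Nat.exists_eq_add_of_le hi
    by_contra hne
    have h1 := window_mem_language fixedPt (l + j) (n + 1)
    have h2 := window_mem_language fixedPt (k + j) (n + 1)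
    rw [window_succ] at h1 h2
    rw [← step j] at h1
    refine hno _ (by simp) ⟨_, _, h1, h2, ?_⟩
    rwa [show l + j + n = k + n + j + (l - k) by omega, show k + j + n = k + n + j by omega]
  rcases lt_or_gt_of_ne hkl with h | h
  · exact main k l h he
  · exact main l k h he.symm

/-! ### Counting occurrences -/

theorem occ_nil_right (w : List (Fin 4)) : occ w [] = 0 := by simp [occ]

theorem occ_cons (w : List (Fin 4)) (a : Fin 4) (v : List (Fin 4)) :
    occ w (a :: v) = occ w v + if w <+: a :: v then 1 else 0 := by
  have hfin : {i : ℕ | i < v.length ∧ w <+: v.drop i}.Finite :=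
    (Set.finite_lt_nat v.length).subset fun i hi => hi.1
  have e : {i : ℕ | i < (a :: v).length ∧ w <+: (a :: v).drop i} =
      Nat.succ '' {i : ℕ | i < v.length ∧ w <+: v.drop i} ∪ {i | i = 0 ∧ w <+: a :: v} := by
    ext i
    cases i with
    | zero => simp
    | succ i => simp
  have hdisj : Disjoint (Nat.succ '' {i : ℕ | i < v.length ∧ w <+: v.drop i})
      {i | i = 0 ∧ w <+: a :: v} := by
    rw [Set.disjoint_left]
    rintro _ ⟨i, -, rfl⟩ ⟨h, -⟩
    exact Nat.succ_ne_zero i h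
  rw [occ, e, Set.ncard_union_eq hdisj (hfin.image _)
    ((Set.finite_singleton 0).subset fun i hi => hi.1),
    Set.ncard_image_of_injective _ Nat.succ_injective, occ]
  congr 1
  split_ifs with h
  · simp [h]
  · simp [h]

theorem occ_nil_left (v : List (Fin 4)) : occ [] v = v.length := by
  induction v with
  | nil => simp [occ_nil_right]
  | cons a v ih => simp [occ_cons, ih]

theorem occ_singleton (c : Fin 4) (v : List (Fin 4)) : occ [c] v = v.count c := by
  induction v with
  | nil => simp [occ_nil_right]
  | cons a v ih =>
    rw [occ_cons, ih, List.count_cons]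
    simp only [List.cons_prefix_cons, List.nil_prefix, and_true, beq_iff_eq, @eq_comm _ c a]

theorem occ_eq_zero {w v : List (Fin 4)} (hw : w ∉ language fixedPt)
    (hv : v ∈ language fixedPt) : occ w v = 0 := by
  induction v with
  | nil => exact occ_nil_right w
  | cons a v ih =>
    rw [occ_cons, ih (mem_language_right (v := [a]) hv), if_neg]
    exact fun h => hw (mem_language_of_infix h.isInfix hv)

/-- Each occurrence of w is followed by exactly one letter unless it is a suffix of v. For empty w
the formula fails, because `occ` does not count the empty word at the end of v. -/
theorem sum_occ_append (w v : List (Fin 4)) (hw : w ≠ []) :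
    ∑ c, occ (w ++ [c]) v + (if w <:+ v then 1 else 0) = occ w v := by
  induction v with
  | nil => simp [occ_nil_right, hw]
  | cons a v ih =>
    simp only [occ_cons, Finset.sum_add_distrib]
    rw [← ih]
    simp only [List.suffix_cons_iff]
    by_cases h1 : w = a :: v
    · have h2 : ∀ c, ¬ w ++ [c] <+: a :: v := fun c h => by
        have := h.length_le
        rw [h1] at this
        simp at this
      have h3 : ¬ w <:+ v := fun h => by
        have := h.length_le
        rw [h1] at this
        simp at this
      rw [if_pos (Or.inl h1), if_neg h3, if_pos (h1 ▸ List.prefix_rfl)]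
      simp [h2]
    · simp only [h1, false_or]
      by_cases h2 : w <+: a :: v
      · obtain ⟨t, ht⟩ := h2
        cases t with
        | nil => exact absurd (by simpa using ht) h1
        | cons d t =>
          have h3 : ∀ c, w ++ [c] <+: a :: v ↔ c = d := fun c => by
            rw [← ht, List.prefix_append_right_inj]
            simp [List.cons_prefix_cons]
          have h4 : w <+: a :: v := ⟨_, ht⟩
          simp [h3, h4]
          omega
      · have h3 : ∀ c, ¬ w ++ [c] <+: a :: v := fun c h => h2 ((List.prefix_append w [c]).trans h)
        simp [h2, h3]

theorem sum_occ_singleton (v : List (Fin 4)) : ∑ c, occ [c] v = v.length := by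
  simp only [occ_singleton]
  induction v with
  | nil => simp
  | cons a v ih => simp [List.count_cons, Finset.sum_add_distrib, ih]

theorem occ_map {f : Fin 4 → Fin 4} (hf : f.Injective) (w v : List (Fin 4)) :
    occ (w.map f) (v.map f) = occ w v := by
  induction v with
  | nil => simp [occ_nil_right]
  | cons a v ih =>
    have : w.map f <+: (a :: v).map f ↔ w <+: a :: v := by
      refine ⟨fun h => ?_, fun h => h.map f⟩
      rw [List.prefix_iff_eq_take, ← List.map_take, List.length_map] at h
      rw [List.prefix_iff_eq_take]
      exact List.map_injective_iff.2 hf h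
    rw [List.map_cons, occ_cons, ih, occ_cons, ← List.map_cons]
    simp only [this]

theorem occ_concat {w : List (Fin 4)} (hw : w ≠ []) (v : List (Fin 4)) (a : Fin 4) :
    occ w (v ++ [a]) = occ w v + if w <:+ v ++ [a] then 1 else 0 := by
  induction v with
  | nil =>
    rw [List.nil_append, occ_cons]
    congr 1
    simp [List.suffix_cons_iff, List.prefix_cons_iff, hw, List.prefix_nil]
  | cons b v ih =>
    have e1 : w <:+ b :: (v ++ [a]) ↔ w = b :: v ++ [a] ∨ w <:+ v ++ [a] := List.suffix_cons_iff
    have e2 : w <+: b :: (v ++ [a]) ↔ w = b :: v ++ [a] ∨ w <+: b :: v :=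
      List.prefix_concat_iff (l₂ := b :: v)
    rw [List.cons_append, occ_cons, ih, occ_cons]
    simp only [e1, e2]
    by_cases h : w = b :: v ++ [a]
    · have h1 : ¬ w <+: b :: v := fun h' => by
        have := h'.length_le
        rw [h] at this
        simp at this
      have h2 : ¬ w <:+ v ++ [a] := fun h' => by
        have := h'.length_le
        rw [h] at this
        simp at this
      simp only [h, true_or]
      simp [← h, h1, h2]
    · simp only [h, false_or]
      omega

theorem occ_reverse {w : List (Fin 4)} (hw : w ≠ []) (v : List (Fin 4)) :
    occ w.reverse v.reverse = occ w v := by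
  induction v with
  | nil => simp [occ_nil_right]
  | cons a v ih =>
    rw [List.reverse_cons, occ_concat (by simpa using hw), ih, occ_cons, ← List.reverse_cons]
    simp only [List.reverse_suffix]

theorem occ_theta1 {w : List (Fin 4)} (hw : w ≠ []) (v : List (Fin 4)) :
    occ (theta1 w) (theta1 v) = occ w v := by
  rw [theta1_apply, theta1_apply, occ_reverse (by simpa using hw),
    occ_map (Equiv.injective _)]

/-! ### Frequencies -/

open Filter Topology

/-- The filter of factors of `fixedPt` whose length tends to infinity. -/
def factorFilter : Filter (List (Fin 4)) :=
  comap List.length atTop ⊓ 𝓟 (language fixedPt)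

instance : factorFilter.NeBot := by
  rw [factorFilter, ((atTop_basis.comap List.length).inf_principal _).neBot_iff]
  intro n _
  exact ⟨window fixedPt 0 n, by simp, window_mem_language _ _ _⟩

theorem eventually_mem_language : ∀ᶠ v in factorFilter, v ∈ language fixedPt :=
  mem_inf_of_right (mem_principal_self _)

theorem tendsto_length : Tendsto (fun v : List (Fin 4) => (v.length : ℝ)) factorFilter atTop :=
  tendsto_natCast_atTop_atTop.comp (tendsto_comap.mono_left inf_le_left)

theorem tendsto_div_length_zero {f : List (Fin 4) → ℝ} {C : ℝ}
    (h : ∀ v ∈ language fixedPt, |f v| ≤ C) :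
    Tendsto (fun v => f v / v.length) factorFilter (𝓝 0) := by
  refine squeeze_zero_norm' (a := fun v => C / (v.length : ℝ)) ?_ ?_
  · filter_upwards [eventually_mem_language] with v hv
    rw [Real.norm_eq_abs, abs_div, Nat.abs_cast]
    gcongr
    exact h v hv
  · exact tendsto_length.const_div_atTop C

theorem HasFrequency.congr {v w : List (Fin 4)} {r C : ℝ} (hv : HasFrequency fixedPt v r)
    (h : ∀ x ∈ language fixedPt, |(occ w x : ℝ) - occ v x| ≤ C) :
    HasFrequency fixedPt w r := by
  have h2 : Tendsto (fun x : List (Fin 4) => (occ v x : ℝ) / (x.length : ℝ)) factorFilter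
    (𝓝 r) := hv
  have h1 := h2.add (tendsto_div_length_zero h)
  rw [add_zero] at h1
  refine h1.congr fun x => ?_
  ring

theorem HasFrequency.unique {w : List (Fin 4)} {r s : ℝ} (hr : HasFrequency fixedPt w r)
    (hs : HasFrequency fixedPt w s) : r = s :=
  haveI : (comap List.length atTop ⊓ 𝓟 (language fixedPt)).NeBot :=
    inferInstanceAs factorFilter.NeBot
  tendsto_nhds_unique hr hs

theorem hasFrequency_zero {w : List (Fin 4)} (hw : w ∉ language fixedPt) :
    HasFrequency fixedPt w 0 := by
  have h : Tendsto (fun v : List (Fin 4) => (occ w v : ℝ) / v.length) factorFilter (𝓝 0) :=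
    tendsto_div_length_zero (C := 0) fun v hv => by simp [occ_eq_zero hw hv]
  exact h

theorem hasFrequency_nil : HasFrequency fixedPt [] 1 := by
  have h : Tendsto (fun v : List (Fin 4) => (occ [] v : ℝ) / v.length) factorFilter (𝓝 1) := by
    refine tendsto_const_nhds.congr' ?_
    filter_upwards [tendsto_length.eventually_gt_atTop 0] with v hv
    rw [occ_nil_left, div_self hv.ne']
  exact h

theorem HasFrequency.theta1 {w : List (Fin 4)} {r : ℝ} (hw : w ≠ [])
    (h : HasFrequency fixedPt w r) : HasFrequency fixedPt (theta1 w) r := by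
  have ht : Tendsto SymWord.theta1 factorFilter factorFilter := by
    refine tendsto_inf.2 ⟨?_, tendsto_principal.2 ?_⟩
    · rw [tendsto_comap_iff]
      exact (tendsto_comap.mono_left inf_le_left).congr fun v => (length_theta1 v).symm
    · filter_upwards [eventually_mem_language] with v hv
      exact theta1_mem_language hv
  refine (Tendsto.comp h ht).congr fun v => ?_
  rw [Function.comp_apply, length_theta1, ← occ_theta1 hw, theta1_theta1]

theorem HasFrequency.map_flip {w : List (Fin 4)} {r : ℝ} (h : HasFrequency fixedPt w r) :
    HasFrequency fixedPt (w.map flip) r := by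
  have ht : Tendsto (List.map flip) factorFilter factorFilter := by
    refine tendsto_inf.2 ⟨?_, tendsto_principal.2 ?_⟩
    · rw [tendsto_comap_iff]
      exact (tendsto_comap.mono_left inf_le_left).congr fun v => (List.length_map _).symm
    · filter_upwards [eventually_mem_language] with v hv
      exact map_flip_mem_language hv
  have hinj : Function.Injective flip := Function.LeftInverse.injective flip_flip
  refine (Tendsto.comp h ht).congr fun v => ?_
  rw [Function.comp_apply, List.length_map, ← occ_map hinj, map_flip_map_flip]

/-! ### Frequencies of letters -/

theorem count_eq (w : List (Fin 4)) :
    w.count 2 + w.count 3 = kindCount w ∧ w.count 0 + w.count 1 + kindCount w = w.length := by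
  induction w with
  | nil => simp [kindCount]
  | cons a w ih =>
    rw [← List.singleton_append, kindCount_append, List.length_append]
    simp only [List.count_append]
    have h : ∀ a : Fin 4, [a].count 2 + [a].count 3 = kindCount [a] ∧
        [a].count 0 + [a].count 1 + kindCount [a] = 1 := by decide
    have := h a
    rw [List.length_singleton]
    omega

/-- The letters `0` and `1` alternate. -/
theorem abs_count_sub_le {w : List (Fin 4)} (hw : w.IsChain Adj) :
    |(w.count 0 : ℤ) - w.count 1| ≤ 1 := by
  -- The induction needs the sign: starting from 0 or 3 the first letter of {0,1} is 0, starting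
  -- from 1 or 2 it is 1.
  have key : ∀ w : List (Fin 4), w.IsChain Adj →
      (∀ a ∈ w.head?, (a = 0 ∨ a = 3) →
        0 ≤ (w.count 0 : ℤ) - w.count 1 ∧ (w.count 0 : ℤ) - w.count 1 ≤ 1) ∧
      (∀ a ∈ w.head?, (a = 1 ∨ a = 2) →
        -1 ≤ (w.count 0 : ℤ) - w.count 1 ∧ (w.count 0 : ℤ) - w.count 1 ≤ 0) := by
    intro w
    induction w with
    | nil => simp
    | cons a w ih =>
      intro h
      rw [List.isChain_cons] at h
      have := ih h.2
      cases w with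
      | nil => revert a; decide
      | cons b w =>
        have hab := h.1 b rfl
        simp only [List.head?_cons, Option.mem_def, Option.some.injEq, forall_eq'] at this ⊢
        rw [List.count_cons (a := 0) (b := a), List.count_cons (a := 1) (b := a)]
        clear h ih
        generalize (b :: w).count 0 = x at *
        generalize (b :: w).count 1 = y at *
        revert hab this
        fin_cases a <;> fin_cases b <;> simp [Adj] <;> omega
  cases w with
  | nil => simp
  | cons a w =>
    have h := key _ hw
    simp only [List.head?_cons, Option.mem_def, Option.some.injEq, forall_eq'] at h
    have ha : ∀ a : Fin 4, (a = 0 ∨ a = 3) ∨ a = 1 ∨ a = 2 := by decide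
    rw [abs_le]
    rcases ha a with ha | ha
    · have := h.1 ha; omega
    · have := h.2 ha; omega

theorem count_phi (w : List (Fin 4)) :
    ((phi w).count 2 : ℤ) - (phi w).count 3 =
      (w.count 2 - w.count 3) - (w.count 0 - w.count 1) := by
  have h : ∀ a, ((phiLetter a).count 2 : ℤ) - (phiLetter a).count 3 =
      ([a].count 2 - [a].count 3) - ([a].count 0 - [a].count 1) := by decide
  induction w with
  | nil => simp [phi_nil]
  | cons a w ih =>
    have := h a
    rw [phi_cons, ← List.singleton_append]
    simp only [List.count_append]
    push_cast
    linarith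

/-- Iterated desubstitution: each step shortens the word by a factor of at least 3 and costs at most
9, namely 1 for the imbalance of 0 and 1 and 4 for each of the two ends. -/
theorem abs_count_sub_le_div (m : ℕ) : ∀ w ∈ language fixedPt,
    |(w.count 2 : ℝ) - w.count 3| ≤ w.length / 3 ^ m + 9 * m := by
  have triv : ∀ w : List (Fin 4), |(w.count 2 : ℝ) - w.count 3| ≤ w.length := by
    intro w
    have h2 : (w.count 2 : ℝ) ≤ w.length := by exact_mod_cast List.count_le_length
    have h3 : (w.count 3 : ℝ) ≤ w.length := by exact_mod_cast List.count_le_length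
    rw [abs_le]
    constructor <;> linarith [Nat.cast_nonneg (α := ℝ) (w.count 2),
      Nat.cast_nonneg (α := ℝ) (w.count 3)]
  induction m with
  | zero => intro w _; simpa using triv w
  | succ m ih =>
    intro w hw
    obtain ⟨p, v, t, rfl, hv, hp, ht⟩ := exists_desubstitution hw
    have h1 := ih v hv
    have h2 : |(v.count 0 : ℝ) - v.count 1| ≤ 1 := by
      exact_mod_cast abs_count_sub_le (isChain_of_mem_language hv)
    have h3 : ((phi v).count 2 : ℝ) - (phi v).count 3 =
      (v.count 2 - v.count 3) - (v.count 0 - v.count 1) := by exact_mod_cast count_phi v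
    have hp' : (p.length : ℝ) ≤ 4 := by exact_mod_cast hp
    have ht' : (t.length : ℝ) ≤ 4 := by exact_mod_cast ht
    have h4 := (triv p).trans hp'
    have h5 := (triv t).trans ht'
    have h6 : (v.length : ℝ) / 3 ^ m ≤ (p ++ phi v ++ t).length / 3 ^ (m + 1) := by
      rw [pow_succ', ← div_div]
      gcongr
      rw [le_div_iff₀' (by norm_num)]
      have := length_phi v
      have : 3 * v.length ≤ (p ++ phi v ++ t).length := by
        simp only [List.length_append]; omega
      exact_mod_cast this
    simp only [List.count_append] at *
    push_cast at *
    rw [abs_le] at *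
    constructor <;> linarith

theorem tendsto_count_sub :
    Tendsto (fun v : List (Fin 4) => ((v.count 2 : ℝ) - v.count 3) / v.length)
      factorFilter (𝓝 0) := by
  rw [Metric.tendsto_nhds]
  intro ε hε
  obtain ⟨m, hm⟩ := exists_pow_lt_of_lt_one (half_pos hε) (by norm_num : (1 / 3 : ℝ) < 1)
  filter_upwards [eventually_mem_language, tendsto_length.eventually_gt_atTop 0,
    tendsto_length.eventually_gt_atTop (9 * m / (ε / 2))] with v hv h0 h1
  rw [Real.dist_eq, sub_zero, abs_div, Nat.abs_cast, div_lt_iff₀ h0]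
  rw [div_lt_iff₀ (half_pos hε)] at h1
  have h2 := abs_count_sub_le_div m v hv
  have h3 : (v.length : ℝ) / 3 ^ m = (1 / 3) ^ m * v.length := by
    rw [one_div, inv_pow]; ring
  rw [h3] at h2
  nlinarith [mul_lt_mul_of_pos_right hm h0]

theorem tendsto_kindCount :
    Tendsto (fun v : List (Fin 4) => (kindCount v : ℝ) / v.length)
      factorFilter (𝓝 slope) := by
  have h1 := (tendsto_div_length_zero fun v hv => (discrepancy hv).le).add_const slope
  rw [zero_add] at h1
  refine h1.congr' ?_
  filter_upwards [tendsto_length.eventually_gt_atTop 0] with v hv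
  field_simp
  ring

theorem hasFrequency_letter (c : Fin 4) :
    HasFrequency fixedPt [c] (if kind c then slope / 2 else (1 - slope) / 2) := by
  have h0 : Tendsto (fun v : List (Fin 4) => ((v.count 0 : ℝ) - v.count 1) / v.length)
      factorFilter (𝓝 0) := tendsto_div_length_zero (C := 1) fun v hv => by
    exact_mod_cast abs_count_sub_le (isChain_of_mem_language hv)
  have h1 := tendsto_count_sub
  have h2 := tendsto_kindCount
  have e1 : ∀ v : List (Fin 4), (v.count 2 : ℝ) + v.count 3 = kindCount v := fun v => by
    exact_mod_cast (count_eq v).1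
  have e2 : ∀ v : List (Fin 4), (v.count 0 : ℝ) + v.count 1 + kindCount v = v.length := fun v => by
    exact_mod_cast (count_eq v).2
  have ev := tendsto_length.eventually_gt_atTop 0
  have k : ∀ (c : Fin 4) (f : List (Fin 4) → ℝ) (r : ℝ), Tendsto f factorFilter (𝓝 r) →
      (∀ v : List (Fin 4), 0 < (v.length : ℝ) → f v = v.count c / v.length) →
      HasFrequency fixedPt [c] r := fun c f r h1 h2 => by
    refine h1.congr' ?_
    filter_upwards [ev] with v hv
    rw [occ_singleton, h2 v hv]
  have k0 := k 0 _ _ (((h2.const_sub 1).add h0).div_const 2) fun v hv => by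
    have := e2 v
    field_simp
    linarith
  have k1 := k 1 _ _ (((h2.const_sub 1).sub h0).div_const 2) fun v hv => by
    have := e2 v
    field_simp
    linarith
  have k2 := k 2 _ _ ((h2.add h1).div_const 2) fun v hv => by
    have := e1 v
    field_simp
    linarith
  have k3 := k 3 _ _ ((h2.sub h1).div_const 2) fun v hv => by
    have := e1 v
    field_simp
    linarith
  rw [add_zero] at k0 k2
  rw [sub_zero] at k1 k3
  fin_cases c
  exacts [k0, k1, k2, k3]

/-! ### Existence of frequencies -/

theorem theta1_cons (c : Fin 4) (w : List (Fin 4)) :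
    theta1 (c :: w) = theta1 w ++ [Equiv.swap 0 1 c] := by simp [theta1_apply]

theorem HasFrequency.append_of_not_rightSpecial {w : List (Fin 4)} {c : Fin 4} {r : ℝ}
    (hne : w ≠ []) (hw : ¬ IsRightSpecial w) (hc : w ++ [c] ∈ language fixedPt)
    (h : HasFrequency fixedPt w r) : HasFrequency fixedPt (w ++ [c]) r := by
  refine h.congr (C := 1) fun v hv => ?_
  have h1 := sum_occ_append w v hne
  rw [Finset.sum_eq_single c (fun b _ hb => occ_eq_zero
    (fun hb' => hw ⟨b, c, hb', hc, hb⟩) hv) (by simp)] at h1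
  rw [← h1]
  split_ifs <;> simp

theorem HasFrequency.append_of_rightSpecial {w : List (Fin 4)} {a b : Fin 4} {r s : ℝ}
    (hne : w ≠ []) (ha : w ++ [a] ∈ language fixedPt) (hb : w ++ [b] ∈ language fixedPt)
    (hab : a ≠ b) (h : HasFrequency fixedPt w r) (hs : HasFrequency fixedPt (w ++ [a]) s) :
    HasFrequency fixedPt (w ++ [b]) (r - s) := by
  have h1 : Tendsto (fun v : List (Fin 4) => ((occ (w ++ [b]) v : ℝ) -
      (occ w v - occ (w ++ [a]) v)) / v.length) factorFilter (𝓝 0) := by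
    refine tendsto_div_length_zero (C := 1) fun v hv => ?_
    have h1 := sum_occ_append w v hne
    rw [← Finset.sum_subset (Finset.subset_univ {a, b}) (fun c _ hc => occ_eq_zero (fun hc' => by
      have : c ∈ rext fixedPt w := hc'
      rw [rext_eq_pair hne ha hb hab] at this
      exact hc (by simpa using this)) hv), Finset.sum_pair hab] at h1
    rw [← h1]
    push_cast
    rw [abs_le]
    split_ifs <;> constructor <;> linarith
  have h2 : Tendsto (fun v : List (Fin 4) => (occ w v : ℝ) / v.length) factorFilter (𝓝 r) := h
  have h3 := h1.add (h2.sub hs)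
  rw [zero_add] at h3
  refine Tendsto.congr (fun v => ?_) h3
  ring

/-- `theta1` preserves frequencies and turns left extensions into right ones. -/
theorem HasFrequency.cons_of_not_leftSpecial {w : List (Fin 4)} {c : Fin 4} {r : ℝ}
    (hne : w ≠ []) (hw : ¬ IsLeftSpecial w) (hc : c :: w ∈ language fixedPt)
    (h : HasFrequency fixedPt w r) : HasFrequency fixedPt (c :: w) r := by
  have h1 := (h.theta1 hne).append_of_not_rightSpecial (theta1_ne_nil hne)
    (fun h => hw (by simpa [theta1_theta1] using h.theta1))
    (by simpa [theta1_cons] using theta1_mem_language hc)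
  rw [← theta1_cons] at h1
  simpa [theta1_theta1] using h1.theta1 (theta1_ne_nil (by simp))

theorem exists_hasFrequency (w : List (Fin 4)) : ∃ r, HasFrequency fixedPt w r := by
  induction hn : w.length generalizing w with
  | zero =>
    obtain rfl := List.length_eq_zero_iff.1 hn
    exact ⟨_, hasFrequency_nil⟩
  | succ n ih =>
    by_cases hw : w ∈ language fixedPt
    swap
    · exact ⟨0, hasFrequency_zero hw⟩
    rcases w with _ | ⟨d, w⟩
    · simp at hn
    rcases List.eq_nil_or_concat' w with rfl | ⟨z, c, rfl⟩
    · exact ⟨_, hasFrequency_letter d⟩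
    rw [← List.cons_append] at hw hn ⊢
    have hl : z.length + 1 = n := by simpa using hn
    obtain ⟨r, hr⟩ := ih (d :: z) (by simpa using hl)
    by_cases hR : IsRightSpecial (d :: z)
    swap
    · exact ⟨r, hr.append_of_not_rightSpecial (by simp) hR hw⟩
    by_cases hL : IsLeftSpecial (z ++ [c])
    swap
    · obtain ⟨s, hs⟩ := ih (z ++ [c]) (by simpa using hl)
      exact ⟨s, hs.cons_of_not_leftSpecial (by simp) hL hw⟩
    -- Now take the other right extension b of `d :: z`. Left special factors of equal length agree
    -- up to `flip`, which preserves kinds, so `z ++ [b]` is not left special. Hence `d :: z ++ [b]`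
    -- has the frequency of the shorter `z ++ [b]`, and the wanted one is obtained by subtraction.
    obtain ⟨b, hb, hbk⟩ := exists_rext_of_kind (by simp) hR (!kind c)
    have hbc : b ≠ c := by rintro rfl; simp at hbk
    have hL' : ¬ IsLeftSpecial (z ++ [b]) := by
      intro h
      rcases h.eq_or_eq hL (by simp) (by simp) with h | h
      · exact hbc (by simpa using h)
      · rw [List.map_append, List.map_singleton] at h
        have := (List.append_inj' h rfl).2
        rw [List.singleton_inj] at this
        rw [this, kind_flip] at hbk
        simp at hbk
    obtain ⟨s, hs⟩ := ih (z ++ [b]) (by simpa using hl)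
    have hs' := hs.cons_of_not_leftSpecial (by simp) hL' hb
    exact ⟨r - s, hr.append_of_rightSpecial (by simp) hb hw hbc hs'⟩

/-- The frequency of a word in `fixedPt`. -/
noncomputable def freq (w : List (Fin 4)) : ℝ := (exists_hasFrequency w).choose

theorem hasFrequency_freq (w : List (Fin 4)) : HasFrequency fixedPt w (freq w) :=
  (exists_hasFrequency w).choose_spec

theorem HasFrequency.freq_eq {w : List (Fin 4)} {r : ℝ} (h : HasFrequency fixedPt w r) :
    freq w = r := (hasFrequency_freq w).unique h

theorem frequencies_eq (n : ℕ) : frequencies fixedPt n = freq '' factors fixedPt n := by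
  ext r
  exact ⟨fun ⟨e, he, h⟩ => ⟨e, he, h.freq_eq⟩, fun ⟨e, he, h⟩ => ⟨e, he, h ▸ hasFrequency_freq e⟩⟩

theorem sum_freq_append (w : List (Fin 4)) : ∑ c, freq (w ++ [c]) = freq w := by
  have h1 : Tendsto (fun v : List (Fin 4) => ∑ c, (occ (w ++ [c]) v : ℝ) / v.length)
      factorFilter (𝓝 (∑ c, freq (w ++ [c]))) :=
    tendsto_finsetSum _ fun c _ => hasFrequency_freq (w ++ [c])
  have h2 : Tendsto (fun v : List (Fin 4) => ((occ w v : ℝ) - ∑ c, (occ (w ++ [c]) v : ℝ)) /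
      v.length) factorFilter (𝓝 0) := by
    refine tendsto_div_length_zero (C := 1) fun v _ => ?_
    rcases eq_or_ne w [] with rfl | hne
    · have := sum_occ_singleton v
      rw [occ_nil_left, ← this]
      simp
    · rw [← sum_occ_append w v hne]
      push_cast
      rw [add_sub_cancel_left]
      split_ifs <;> simp
  have h3 := h1.add h2
  rw [add_zero] at h3
  have h4 : HasFrequency fixedPt w (∑ c, freq (w ++ [c])) :=
    Tendsto.congr (fun v => by rw [← Finset.sum_div]; ring) h3
  exact h4.freq_eq.symm

theorem freq_theta1 {w : List (Fin 4)} (hne : w ≠ []) : freq (theta1 w) = freq w :=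
  ((hasFrequency_freq w).theta1 hne).freq_eq

theorem freq_map_flip (w : List (Fin 4)) : freq (w.map flip) = freq w :=
  (hasFrequency_freq w).map_flip.freq_eq

theorem freq_append_of_not_rightSpecial {w : List (Fin 4)} {c : Fin 4} (hne : w ≠ [])
    (hw : ¬ IsRightSpecial w) (hc : w ++ [c] ∈ language fixedPt) :
    freq (w ++ [c]) = freq w :=
  ((hasFrequency_freq w).append_of_not_rightSpecial hne hw hc).freq_eq

theorem freq_cons_of_not_leftSpecial {w : List (Fin 4)} {c : Fin 4} (hne : w ≠ [])
    (hw : ¬ IsLeftSpecial w) (hc : c :: w ∈ language fixedPt) : freq (c :: w) = freq w :=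
  ((hasFrequency_freq w).cons_of_not_leftSpecial hne hw hc).freq_eq

theorem freq_append_of_rightSpecial {w : List (Fin 4)} {a b : Fin 4} (hne : w ≠ [])
    (ha : w ++ [a] ∈ language fixedPt) (hb : w ++ [b] ∈ language fixedPt) (hab : a ≠ b) :
    freq w = freq (w ++ [a]) + freq (w ++ [b]) := by
  rw [((hasFrequency_freq w).append_of_rightSpecial hne ha hb hab (hasFrequency_freq _)).freq_eq]
  ring

/-- The frequencies of the factors of a given positive length are not commensurable. -/
theorem freq_not_commensurable {m : ℕ} (hm : 1 ≤ m) (x : ℝ)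
    (h : ∀ e ∈ factors fixedPt m, ∃ k : ℤ, freq e = k * x) : False := by
  -- Summing over right extensions carries commensurability down to shorter words, in particular to
  -- the empty word and the letter 2, of frequencies 1 and s/2.
  have key : ∀ d (w : List (Fin 4)), w.length + d = m → ∃ k : ℤ, freq w = k * x := by
    intro d
    induction d with
    | zero =>
      intro w hw
      by_cases hL : w ∈ language fixedPt
      · exact h w ⟨hL, hw⟩
      · exact ⟨0, by rw [(hasFrequency_zero hL).freq_eq]; simp⟩
    | succ d ih =>
      intro w hw
      have := fun c => ih (w ++ [c]) (by simp; omega)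
      choose k hk using this
      refine ⟨∑ c, k c, ?_⟩
      rw [← sum_freq_append, Int.cast_sum, Finset.sum_mul]
      exact Finset.sum_congr rfl fun c _ => hk c
  obtain ⟨k, hk⟩ := key m [] (by simp)
  obtain ⟨j, hj⟩ := key (m - 1) [2] (by simp; omega)
  rw [hasFrequency_nil.freq_eq] at hk
  rw [(hasFrequency_letter 2).freq_eq, if_pos (by decide)] at hj
  refine irrational_slope ⟨2 * (j : ℚ) / k, ?_⟩
  have hk0 : (k : ℝ) ≠ 0 := by rintro h; rw [h] at hk; simp at hk
  push_cast
  rw [div_eq_iff hk0]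
  linear_combination (-2 * k : ℝ) * hj + 2 * j * hk

/-- The frequency of a factor equals that of one which ends in a special factor. -/
theorem freq_mem_of_special {n : ℕ} (hn : 1 ≤ n) {S : Set ℝ}
    (hS : ∀ c w, w.length = n → c :: w ∈ language fixedPt →
      IsLeftSpecial w ∨ IsRightSpecial w → freq (c :: w) ∈ S) :
    ∀ e ∈ factors fixedPt (n + 1), freq e ∈ S := by
  -- Consecutive windows of length n+1 overlap in a factor of length n; if it is not special, both
  -- have its frequency. Recurrence of a right special factor makes the slide stop.
  have key : ∀ j k, IsRightSpecial (window fixedPt (k + 1 + j) n) →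
      freq (window fixedPt k (n + 1)) ∈ S := by
    have base : ∀ k, IsLeftSpecial (window fixedPt (k + 1) n) ∨
        IsRightSpecial (window fixedPt (k + 1) n) → freq (window fixedPt k (n + 1)) ∈ S := by
      intro k h
      have hm := window_mem_language fixedPt k (n + 1)
      rw [window_succ'] at hm ⊢
      exact hS _ _ (by simp) hm h
    intro j
    induction j with
    | zero => exact fun k h => base k (Or.inr h)
    | succ j ih =>
      intro k h
      by_cases hs : IsLeftSpecial (window fixedPt (k + 1) n) ∨
        IsRightSpecial (window fixedPt (k + 1) n)
      · exact base k hs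
      · push Not at hs
        have hne : window fixedPt (k + 1) n ≠ [] := fun h => by
          have := congrArg List.length h
          simp at this
          omega
        have h1 := ih (k + 1) (by rwa [show k + 1 + 1 + j = k + 1 + (j + 1) by omega])
        have hm1 := window_mem_language fixedPt (k + 1) (n + 1)
        have hm2 := window_mem_language fixedPt k (n + 1)
        rw [window_succ] at h1 hm1
        rw [freq_append_of_not_rightSpecial hne hs.2 hm1] at h1
        rw [window_succ'] at hm2 ⊢
        rwa [freq_cons_of_not_leftSpecial hne hs.1 hm2]
  rintro e ⟨he, hl⟩
  obtain ⟨k, hk⟩ := he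
  obtain ⟨R, hRl, hR⟩ := exists_isRightSpecial n
  obtain ⟨g, hg⟩ := isUniformlyRecurrent_fixedPt R hR.mem_language
  obtain ⟨i, hi, -, hRi⟩ := hg (k + 1)
  obtain ⟨j, rfl⟩ := Nat.exists_eq_add_of_le hi
  rw [hk, hl]
  refine key j k ?_
  rwa [← hRl, ← hRi]

theorem ne_nil_of_length {n : ℕ} (hn : 1 ≤ n) {w : List (Fin 4)} (hw : w.length = n) :
    w ≠ [] := by
  rintro rfl
  simp at hw
  omega

/-- The frequencies of the extensions of special factors. -/
theorem exists_freq_special {n : ℕ} (hn : 1 ≤ n) : ∃ x y : ℝ,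
    (∃ e ∈ factors fixedPt (n + 1), freq e = x) ∧ (∃ e ∈ factors fixedPt (n + 1), freq e = y) ∧
    (∀ w, w.length = n → IsRightSpecial w → freq w = x + y) ∧
    ∀ w c, w.length = n → IsLeftSpecial w → c :: w ∈ language fixedPt →
      freq (c :: w) = x ∨ freq (c :: w) = y := by
  obtain ⟨R, hRl, hR⟩ := exists_isRightSpecial n
  have hne := ne_nil_of_length hn hRl
  obtain ⟨a, b, ha, hb, hab⟩ := id hR
  refine ⟨freq (R ++ [a]), freq (R ++ [b]), ⟨_, ⟨ha, by simp [hRl]⟩, rfl⟩,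
    ⟨_, ⟨hb, by simp [hRl]⟩, rfl⟩, fun w hw hwR => ?_, fun w c hw hwL hc => ?_⟩
  · rw [← freq_append_of_rightSpecial hne ha hb hab]
    rcases hwR.eq_or_eq hR (hw.trans hRl.symm) (ne_nil_of_length hn hw) with rfl | rfl
    · rfl
    · exact freq_map_flip R
  · have key : ∀ d, R ++ [d] ∈ language fixedPt → d = a ∨ d = b := fun d hd => by
      have : d ∈ rext fixedPt R := hd
      rw [rext_eq_pair hne ha hb hab] at this
      simpa using this
    -- `theta1` turns a left extension of w into a right extension of R or of its `flip`, with the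
    -- same frequency.
    have hm := theta1_mem_language hc
    rw [← freq_theta1 (by simp : c :: w ≠ [])]
    rw [theta1_cons] at hm ⊢
    generalize Equiv.swap 0 1 c = d at *
    rcases hwL.theta1.eq_or_eq hR (by rw [length_theta1, hw, hRl])
      (theta1_ne_nil (ne_nil_of_length hn hw)) with h | h
    · rw [h] at hm ⊢
      rcases key d hm with rfl | rfl <;> simp
    · rw [h] at hm ⊢
      rw [← freq_map_flip]
      have hm' := map_flip_mem_language hm
      rw [List.map_append, map_flip_map_flip, List.map_singleton] at hm' ⊢
      rcases key _ hm' with h | h <;> simp [h]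

/-- One bispecial factor forces both right special factors of its length to be bispecial, as `flip`
exchanges them. -/
theorem isRightSpecial_of_isBispecial {n : ℕ} (hn : 1 ≤ n) {v w : List (Fin 4)}
    (hv : IsBispecial fixedPt v) (hvl : v.length = n) (hwl : w.length = n) :
    IsRightSpecial w → IsLeftSpecial w := by
  intro hw
  rw [isBispecial_iff] at hv
  rcases hw.eq_or_eq hv.2 (hwl.trans hvl.symm) (ne_nil_of_length hn hwl) with rfl | rfl
  · exact hv.1
  · exact isLeftSpecial_map_flip hv.1

theorem frequencies_of_le {n : ℕ} (hn : 1 ≤ n) : ∃ x y : ℝ, x ≠ y ∧ x ≠ 0 ∧ y ≠ 0 ∧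
    ((∃ w ∈ factors fixedPt n, IsBispecial fixedPt w) → frequencies fixedPt (n + 1) = {x, y}) ∧
    ((¬ ∃ w ∈ factors fixedPt n, IsBispecial fixedPt w) →
      frequencies fixedPt (n + 1) = {x, y, x + y}) := by
  obtain ⟨x, y, ⟨e, he, hex⟩, ⟨f, hf, hfy⟩, hsum, hleft⟩ := exists_freq_special hn
  have hall : ∀ e ∈ factors fixedPt (n + 1), freq e = x ∨ freq e = y ∨ freq e = x + y := by
    refine freq_mem_of_special hn (S := {r | r = x ∨ r = y ∨ r = x + y}) fun c w hw hc h => ?_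
    by_cases hL : IsLeftSpecial w
    · rcases hleft w c hw hL hc with h | h
      · exact Or.inl h
      · exact Or.inr (Or.inl h)
    · refine Or.inr (Or.inr ?_)
      rw [freq_cons_of_not_leftSpecial (ne_nil_of_length hn hw) hL hc]
      exact hsum w hw (h.resolve_left hL)
  have hn1 : 1 ≤ n + 1 := by omega
  refine ⟨x, y, ?_, ?_, ?_, ?_, ?_⟩
  · rintro rfl
    refine freq_not_commensurable hn1 x fun e he => ?_
    rcases hall e he with h | h | h
    · exact ⟨1, by simp [h]⟩
    · exact ⟨1, by simp [h]⟩
    · exact ⟨2, by rw [h]; push_cast; ring⟩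
  · intro hx
    refine freq_not_commensurable hn1 y fun e he => ?_
    rcases hall e he with h | h | h
    · exact ⟨0, by simp [h, hx]⟩
    · exact ⟨1, by simp [h]⟩
    · exact ⟨1, by simp [h, hx]⟩
  · intro hy
    refine freq_not_commensurable hn1 x fun e he => ?_
    rcases hall e he with h | h | h
    · exact ⟨1, by simp [h]⟩
    · exact ⟨0, by simp [h, hy]⟩
    · exact ⟨1, by simp [h, hy]⟩
  · rintro ⟨v, hv, hvb⟩
    rw [frequencies_eq]
    refine Set.Subset.antisymm ?_ ?_
    · rintro _ ⟨e, he, rfl⟩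
      refine freq_mem_of_special hn (S := {x, y}) (fun c w hw hc h => ?_) e he
      exact hleft w c hw
        (h.elim id (isRightSpecial_of_isBispecial hn hvb hv.2 hw)) hc
    · rintro _ (rfl | rfl)
      exacts [⟨e, he, hex⟩, ⟨f, hf, hfy⟩]
  · intro hno
    rw [frequencies_eq]
    refine Set.Subset.antisymm ?_ ?_
    · rintro _ ⟨e, he, rfl⟩
      exact hall e he
    · rintro _ (rfl | rfl | rfl)
      · exact ⟨e, he, hex⟩
      · exact ⟨f, hf, hfy⟩
      · obtain ⟨R, hRl, hR⟩ := exists_isRightSpecial n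
        have hL : ¬ IsLeftSpecial R := fun hL =>
          hno ⟨R, ⟨hR.mem_language, hRl⟩, isBispecial_iff.2 ⟨hL, hR⟩⟩
        obtain ⟨c, hc⟩ := lext_nonempty hR.mem_language
        refine ⟨c :: R, ⟨hc, by simp [hRl]⟩, ?_⟩
        rw [freq_cons_of_not_leftSpecial (ne_nil_of_length hn hRl) hL hc, hsum R hRl hR]

/-! ### Counting factors -/

theorem finite_factors (n : ℕ) : (factors fixedPt n).Finite :=
  (List.finite_length_eq (Fin 4) n).subset fun _ h => h.2

theorem ncard_rightSpecial {n : ℕ} (hn : 1 ≤ n) :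
    {w | w.length = n ∧ IsRightSpecial w}.ncard = 2 := by
  obtain ⟨R, hRl, hR⟩ := exists_isRightSpecial n
  have e : {w | w.length = n ∧ IsRightSpecial w} = {R, R.map flip} := by
    ext w
    constructor
    · rintro ⟨hw, h⟩
      exact h.eq_or_eq hR (hw.trans hRl.symm) (ne_nil_of_length hn hw)
    · rintro (rfl | rfl)
      · exact ⟨hRl, hR⟩
      · exact ⟨by simpa using hRl, isRightSpecial_map_flip hR⟩
  rw [e, Set.ncard_pair (map_flip_ne (ne_nil_of_length hn hRl)).symm]

/-- Deleting the last letter maps factors of length n+1 onto those of length n, with fibres of size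
2 over the two right special factors and 1 elsewhere. -/
theorem deltaC_eq {n : ℕ} (hn : 1 ≤ n) : deltaC fixedPt n = 2 := by
  classical
  have h : complexity fixedPt (n + 1) = complexity fixedPt n + 2 := by
    rw [complexity, complexity, Set.ncard_eq_toFinset_card _ (finite_factors (n + 1)),
      Set.ncard_eq_toFinset_card _ (finite_factors n), ← ncard_rightSpecial hn]
    rw [Finset.card_eq_sum_card_fiberwise (f := List.dropLast)
      (t := (finite_factors n).toFinset) ?_]
    · have hfib : ∀ w ∈ (finite_factors n).toFinset,
          ((finite_factors (n + 1)).toFinset.filter fun e => e.dropLast = w).card =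
            1 + if IsRightSpecial w then 1 else 0 := by
        intro w hw
        rw [Set.Finite.mem_toFinset] at hw
        have e : (((finite_factors (n + 1)).toFinset.filter fun e => e.dropLast = w :
            Finset (List (Fin 4))) : Set (List (Fin 4))) = (fun c => w ++ [c]) '' rext fixedPt w := by
          ext v
          simp only [Finset.coe_filter, Set.Finite.mem_toFinset, Set.mem_ofPred_eq, Set.mem_image]
          constructor
          · rintro ⟨hv, rfl⟩
            have hne := ne_nil_of_length (by omega) hv.2
            refine ⟨v.getLast hne, ?_, List.dropLast_append_getLast hne⟩
            change _ ∈ language fixedPt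
            rw [List.dropLast_append_getLast]
            exact hv.1
          · rintro ⟨c, hc, rfl⟩
            exact ⟨⟨hc, by simp [hw.2]⟩, by simp⟩
        rw [← Set.ncard_coe_finset, e, Set.ncard_image_of_injective _ fun a b hab => by
          simpa using hab]
        split_ifs with hR
        · obtain ⟨a, b, ha, hb, hab⟩ := hR
          rw [rext_eq_pair (ne_nil_of_length hn hw.2) ha hb hab, Set.ncard_pair hab]
        · rw [isRightSpecial_iff] at hR
          have := (Set.ncard_pos (Set.toFinite _)).2 (rext_nonempty hw.1)
          omega
      rw [Finset.sum_congr rfl hfib, Finset.sum_add_distrib, Finset.sum_boole]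
      simp only [Finset.sum_const, smul_eq_mul, mul_one, Nat.cast_id]
      congr 1
      rw [← Set.ncard_coe_finset]
      congr 1
      ext w
      simp only [Finset.coe_filter, Set.Finite.mem_toFinset, Set.mem_ofPred_eq]
      exact ⟨fun h => ⟨h.1.2, h.2⟩, fun h => ⟨⟨h.2.mem_language, h.1⟩, h.2⟩⟩
    · intro v hv
      simp only [Set.Finite.coe_toFinset] at hv ⊢
      exact ⟨mem_language_of_infix (List.dropLast_prefix v).isInfix hv.1, by simp [hv.2]⟩
  rw [deltaC, h]
  push_cast
  ring

theorem ncard_bispecials {n : ℕ} (hn : 1 ≤ n)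
    (h : ∃ w ∈ factors fixedPt n, IsBispecial fixedPt w) :
    (bispecials fixedPt n).ncard = 2 := by
  obtain ⟨v, hv, hvb⟩ := h
  rw [← ncard_rightSpecial hn]
  congr 1
  ext w
  exact ⟨fun h => ⟨h.2, (isBispecial_iff.1 h.1).2⟩, fun h => ⟨isBispecial_iff.2
    ⟨isRightSpecial_of_isBispecial hn hvb hv.2 h.1 h.2, h.2⟩, h.1⟩⟩

/-- The image under θ₁ is again right special, so it is w or its `flip`; in the second case θ₂ fixes
w. -/
theorem IsBispecial.palindrome {w : List (Fin 4)} (h : IsBispecial fixedPt w) (hne : w ≠ []) :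
    theta1 w = w ∨ theta2 w = w := by
  rw [isBispecial_iff] at h
  rcases h.1.theta1.eq_or_eq h.2 (length_theta1 w) (theta1_ne_nil hne) with h | h
  · exact Or.inl h
  · rw [theta1_eq] at h
    refine Or.inr ?_
    rw [← map_flip_map_flip (theta2 w), h, map_flip_map_flip]

theorem palindromic_bispecials {n : ℕ} (hn : 1 ≤ n) :
    {w ∈ bispecials fixedPt n | theta1 w = w ∨ theta2 w = w} = bispecials fixedPt n := by
  ext w
  exact ⟨fun h => h.1, fun h => ⟨h, h.1.palindrome (ne_nil_of_length hn h.2)⟩⟩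

/-! ### The group -/

theorem mem_symGroup {f : Equiv.Perm (List (Fin 4))} :
    f ∈ symGroup ↔ f = 1 ∨ f = theta1 ∨ f = theta2 ∨ f = theta1 * theta2 := Iff.rfl

theorem isMorphism_one : IsMorphism ((1 : Equiv.Perm (List (Fin 4))) : _ → _) := fun _ _ => rfl

theorem isMorphism_theta12 : IsMorphism (theta1 * theta2) := fun v w => by
  simp [theta12_apply, -Equiv.Perm.coe_mul]

theorem card_symGroup : Nat.card symGroup = 4 := by
  have e1 : theta1 [0, 2] = [2, 1] := by decide
  have e2 : theta2 [0, 2] = [3, 0] := by decide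
  have e3 : (theta1 * theta2) [0, 2] = [1, 3] := by decide
  have ne : ∀ {f g : Equiv.Perm (List (Fin 4))}, f [0, 2] ≠ g [0, 2] → f ≠ g :=
    fun h hfg => h (hfg ▸ rfl)
  change Nat.card ({1, theta1, theta2, theta1 * theta2} : Set (Equiv.Perm (List (Fin 4)))) = 4
  have h1 : (1 : Equiv.Perm (List (Fin 4))) ≠ theta1 := ne (by rw [e1]; decide)
  have h2 : (1 : Equiv.Perm (List (Fin 4))) ≠ theta2 := ne (by rw [e2]; decide)
  have h3 : (1 : Equiv.Perm (List (Fin 4))) ≠ theta1 * theta2 := ne (by rw [e3]; decide)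
  have h4 : theta1 ≠ theta2 := ne (by rw [e1, e2]; decide)
  have h5 : theta1 ≠ theta1 * theta2 := ne (by rw [e1, e3]; decide)
  have h6 : theta2 ≠ theta1 * theta2 := ne (by rw [e2, e3]; decide)
  rw [Nat.card_coe_set_eq, Set.ncard_insert_of_notMem (by
      rintro (h | h | h)
      exacts [h1 h, h2 h, h3 h]),
    Set.ncard_insert_of_notMem (by
      rintro (h | h)
      exacts [h4 h, h5 h]), Set.ncard_pair h6]

theorem isPrimitiveMorph_phiLetter : IsPrimitiveMorph phiLetter := by
  refine ⟨2, fun i j => ?_⟩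
  rw [pow_two, Matrix.mul_apply]
  revert i j
  decide

end SymWord

theorem mainTheorem4 :
    -- `phi` is primitive, every `phi^n(0)` is a prefix of `fixedPt`, and `phi` fixes `fixedPt`
    IsPrimitiveMorph phiLetter ∧
    (∀ n : ℕ, IsPrefixOf (phi^[n] [0]) fixedPt) ∧
    (∀ n : ℕ, IsPrefixOf (phi (window fixedPt 0 n)) fixedPt) ∧
    -- `fixedPt` is uniformly recurrent, aperiodic, and has factor frequencies
    IsUniformlyRecurrent fixedPt ∧
    IsAperiodic fixedPt ∧
    (∀ w ∈ language fixedPt, ∃ r : ℝ, HasFrequency fixedPt w r) ∧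
    -- the group consists of (anti)morphisms, its antimorphisms are `theta1` and `theta2`, and
    -- the language is invariant under it
    (∀ f ∈ symGroup, IsMorphism f ∨ IsAntimorphism f) ∧
    (∀ f ∈ symGroup,
      (IsAntimorphism f ↔ f = theta1 ∨ f = theta2)) ∧
    (∀ f ∈ symGroup, ∀ w ∈ language fixedPt,
      f w ∈ language fixedPt) ∧
    Nat.card symGroup = 4 ∧
    -- the bound is attained, and the values
    ∀ n : ℕ, 1 ≤ n →
      ((frequencies fixedPt (n + 1)).ncard : ℚ) =
        (1 / (Nat.card symGroup : ℚ)) *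
          (4 * (deltaC fixedPt n : ℚ) + (Nat.card symGroup : ℚ)
            - ((bispecials fixedPt n).ncard : ℚ)
            - (({w ∈ bispecials fixedPt n |
                theta1 w = w ∨ theta2 w = w}).ncard : ℚ)) ∧
      ((∃ w ∈ factors fixedPt n, IsBispecial fixedPt w) →
        (frequencies fixedPt (n + 1)).ncard = 2) ∧
      ((¬ ∃ w ∈ factors fixedPt n, IsBispecial fixedPt w) →
        (frequencies fixedPt (n + 1)).ncard = 3) := by
  refine ⟨isPrimitiveMorph_phiLetter, isPrefixOf_fixedPt, phi_window_isPrefixOf,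
    isUniformlyRecurrent_fixedPt, isAperiodic_fixedPt, fun w _ => exists_hasFrequency w,
    ?_, ?_, ?_, card_symGroup, ?_⟩
  · intro f hf
    rcases mem_symGroup.1 hf with rfl | rfl | rfl | rfl
    · exact Or.inl isMorphism_one
    · exact Or.inr theta1_append
    · exact Or.inr theta2_append
    · exact Or.inl isMorphism_theta12
  · intro f hf
    refine ⟨fun h => ?_, by rintro (rfl | rfl); exacts [theta1_append, theta2_append]⟩
    rcases mem_symGroup.1 hf with rfl | rfl | rfl | rfl
    -- A morphism preserving letter order cannot reverse the word 02.
    · exact absurd (h [0] [2]) (by decide)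
    · exact Or.inl rfl
    · exact Or.inr rfl
    · exact absurd (h [0] [2]) (by decide)
  · intro f hf w hw
    rcases mem_symGroup.1 hf with rfl | rfl | rfl | rfl
    · exact hw
    · exact theta1_mem_language hw
    · exact theta2_mem_language hw
    · exact theta1_mem_language (theta2_mem_language hw)
  · intro n hn
    obtain ⟨x, y, hxy, hx, hy, hb, hnb⟩ := frequencies_of_le hn
    have h2 : (∃ w ∈ factors fixedPt n, IsBispecial fixedPt w) →
        (frequencies fixedPt (n + 1)).ncard = 2 := fun h => by
      rw [hb h, Set.ncard_pair hxy]
    have h3 : (¬ ∃ w ∈ factors fixedPt n, IsBispecial fixedPt w) →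
        (frequencies fixedPt (n + 1)).ncard = 3 := fun h => by
      rw [hnb h, Set.ncard_eq_three]
      exact ⟨x, y, x + y, hxy, by simpa using hy, by simpa using hx, rfl⟩
    refine ⟨?_, h2, h3⟩
    -- Here X = Y, so the right side is (12 - 2X)/4, which is 2 for X = 2 and 3 for X = 0.
    rw [card_symGroup, deltaC_eq hn, palindromic_bispecials hn]
    by_cases h : ∃ w ∈ factors fixedPt n, IsBispecial fixedPt w
    · rw [h2 h, ncard_bispecials hn h]
      norm_num
    · have he : bispecials fixedPt n = ∅ := by
        ext w
        simp only [Set.mem_empty_iff_false, iff_false]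
        exact fun hw => h ⟨w, ⟨hw.1.1, hw.2⟩, hw.1⟩
      rw [h3 h, he, Set.ncard_empty]
      norm_num
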